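/- Let $M$ be a smooth Riemannian manifold without boundary (Hausdorff, $\sigma$-compact) of dimension $d\ge 1$, with a Riemannian volume form $\mu$ (so $M$ is oriented by $\mu$), and let $\Gamma\subset M$ be a smooth embedded hypersurface dividing $M$ into open regions $D^+$ and $D^-$, $M=D^+\sqcup\Gamma\sqcup D^-$, lying on the two sides of $\Gamma$; orient $\Gamma$ as the boundary of $D^+$. Let $\chi^\pm$ be the characteristic functions of $D^\pm$. Let $\mathrm{DC}^\infty(M,\Gamma)$ be the space of functions $f=\chi^+f^++\chi^-f^-$ with $f^\pm$ smooth on $D^\pm$ up to $\Gamma$, put $\mathrm{jump}(f)=f^+|_\Gamma-f^-|_\Gamma\in C^\infty(\Gamma)$, and let $\mathrm{DVect}(M,\Gamma)$ be the space of compactly supported vector fields $v=\chi^+v^++\chi^-v^-$ with $v^\pm$ smooth on $D^\pm$ up to $\Gamma$ and $v^+|_\Gamma-v^-|_\Gamma$ tangent to $\Gamma$ (if $M$ is compact, the condition on the support is void). Regularized operators act on each side separately: $d^{\mathcal R}f=\chi^+df^++\chi^-df^-$ and $\mathrm{div}^{\mathcal R}(v)=\chi^+\mathrm{div}(v^+)+\chi^-\mathrm{div}(v^-)$,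 where $L_v\mu=\mathrm{div}(v)\mu$. The anchor $\#v$ is the normal component of $v^+|_\Gamma$ (equivalently of $v^-|_\Gamma$), identified with the $(d-1)$-form $i_{\#v}\mu|_\Gamma$. An element $\tilde n=n\otimes\mathrm{Dense}(\Gamma)$ of $T^*_\Gamma \mathrm V(M)$ is given by a function $n\in C^\infty(\Gamma)$ and is paired with it by $\langle\tilde n,\#v\rangle=\int_\Gamma n\, i_{\#v}\mu$. Let $\mathrm{DVect}(M,\Gamma)'$ be the space of linear functionals on $\mathrm{DVect}(M,\Gamma)$. A discontinuous $1$-form density $m\otimes\mu$ is regarded as the functional $\langle m\otimes\mu,v\rangle=\int_M (i_vm)\mu$, and for $f\in \mathrm{DC}^\infty(M,\Gamma)$ the symbol $T^{\mathcal R}f\otimes\mu$ denotes the functional defined by $$\langle T^{\mathcal R}f\otimes\mu,v\rangle=\int_M \mathrm{div}^{\mathcal R}(v)\,f\,\mu .$$ Then all these integrals converge; $f\mapsto d^{\mathcal R}f\otimes\mu$, $f\mapsto T^{\mathcal R}f\otimes\mu$ and the dual of the anchor, $\#^*$, defined by $\langle\#^*\tilde n,v\rangle=\langle\tilde n,\#v\rangle$,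 are well-defined linear maps into $\mathrm{DVect}(M,\Gamma)'$; and for every $n\in C^\infty(\Gamma)$ there is some $h\in \mathrm{DC}^\infty(M,\Gamma)$ with $\mathrm{jump}(h)=n$, and for every such $h$ $$\#^*\tilde n=(d^{\mathcal R}h+T^{\mathcal R}h)\otimes\mu .$$ In other words, $\{(d^{\mathcal R}h+T^{\mathcal R}h)\otimes\mu \mid h\in \mathrm{DC}^\infty(M,\Gamma),\ \mathrm{jump}(h)=n\}=\{\#^*\tilde n\}$. -/

import Mathlib

open Set MeasureTheory Manifold Bundle
open scoped ContDiff Topology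

universe u

noncomputable section

/-- The component of a vector `w` orthogonal to the subspace `K`. -/
def orthogonalPart {V : Type*} [NormedAddCommGroup V] [InnerProductSpace ℝ V]
    [FiniteDimensional ℝ V] (K : Submodule ℝ V) (w : V) : V :=
  w - K.starProjection w

/-- The coordinate vector field `∂_j` of a chart `e` of `M`, at the point of `M` whose coordinates
are `y`. -/
def coordVector {d : ℕ} {M : Type*} [TopologicalSpace M]
    [ChartedSpace (EuclideanSpace ℝ (Fin d)) M]
    (e : OpenPartialHomeomorph M (EuclideanSpace ℝ (Fin d))) (y : EuclideanSpace ℝ (Fin d))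
    (j : Fin d) : TangentSpace (𝓡 d) (e.symm y) :=
  mfderiv (𝓡 d) (𝓡 d) e.symm y (EuclideanSpace.single j (1 : ℝ))

/-- Exterior forms of degree `k` (not necessarily continuous) on `M`. -/
abbrev FormField (d k : ℕ) (M : Type*) [TopologicalSpace M]
    [ChartedSpace (EuclideanSpace ℝ (Fin d)) M] : Type _ :=
  (x : M) → (TangentSpace (𝓡 d) x) [⋀^Fin k]→ₗ[ℝ] ℝ

/-- The coefficient `ρ` of a top-degree form `μ = ρ dx₁ ∧ ⋯ ∧ dx_d` in the chart `e`. -/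
def chartCoeff {d : ℕ} {M : Type*} [TopologicalSpace M]
    [ChartedSpace (EuclideanSpace ℝ (Fin d)) M] (μ : FormField d d M)
    (e : OpenPartialHomeomorph M (EuclideanSpace ℝ (Fin d))) (y : EuclideanSpace ℝ (Fin d)) : ℝ :=
  μ (e.symm y) (coordVector e y)

/-- `μ` is a Riemannian volume form: a smooth top-degree form taking the values `±1` on orthonormal
frames. Such a form is the volume form of the metric and of the orientation for which it is
positive. -/
structure IsRiemannianVolumeForm {d : ℕ} {M : Type*} [TopologicalSpace M]
    [ChartedSpace (EuclideanSpace ℝ (Fin d)) M]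
    [RiemannianBundle (fun x : M => TangentSpace (𝓡 d) x)] (μ : FormField d d M) : Prop where
  smooth : ∀ e ∈ IsManifold.maximalAtlas (𝓡 d) ∞ M, ContDiffOn ℝ ∞ (chartCoeff μ e) e.target
  abs_eq_one : ∀ (x : M) (b : Fin d → TangentSpace (𝓡 d) x), Orthonormal ℝ b → |μ x b| = 1

/-- The measure `|ρ| dx₁ ⋯ dx_d` on the domain of the chart `e`. -/
def chartMeasure {d : ℕ} {M : Type*} [TopologicalSpace M] [MeasurableSpace M]
    [ChartedSpace (EuclideanSpace ℝ (Fin d)) M] (μ : FormField d d M)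
    (e : OpenPartialHomeomorph M (EuclideanSpace ℝ (Fin d))) : Measure M :=
  Measure.map e.symm
    ((volume.restrict e.target).withDensity (fun y => ENNReal.ofReal |chartCoeff μ e y|))

/-- The measure on `M` given by a volume form `μ`: the least measure dominating
`|ρ| dx₁ ⋯ dx_d` in every chart. By the change of variables formula these local measures agree on
overlaps, so that it coincides with each of them on the domain of the chart. The integral
`∫_M f μ`, for the orientation in which `μ` is positive, is the integral of `f` against it. -/
def volMeasure {d : ℕ} {M : Type*} [TopologicalSpace M] [MeasurableSpace M]
    [ChartedSpace (EuclideanSpace ℝ (Fin d)) M] (μ : FormField d d M) : Measure M :=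
  ⨆ x : M, chartMeasure μ (chartAt (EuclideanSpace ℝ (Fin d)) x)

/-- The component `v^i` of a vector field in the chart `e`, as a function of the coordinates. -/
def chartComponent {d : ℕ} {M : Type*} [TopologicalSpace M]
    [ChartedSpace (EuclideanSpace ℝ (Fin d)) M]
    (e : OpenPartialHomeomorph M (EuclideanSpace ℝ (Fin d)))
    (v : (x : M) → TangentSpace (𝓡 d) x) (i : Fin d) (y : EuclideanSpace ℝ (Fin d)) : ℝ :=
  (show EuclideanSpace ℝ (Fin d) from
    mfderiv (𝓡 d) (𝓡 d) e (e.symm y) (v (e.symm y))) i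

/-- The divergence of a vector field with respect to a volume form, `L_v μ = div(v) μ`:
in a chart where `μ = ρ dx₁ ∧ ⋯ ∧ dx_d`, it is `ρ⁻¹ ∑ᵢ ∂ᵢ(ρ v^i)`. -/
def divergence {d : ℕ} {M : Type*} [TopologicalSpace M]
    [ChartedSpace (EuclideanSpace ℝ (Fin d)) M] (μ : FormField d d M)
    (v : (x : M) → TangentSpace (𝓡 d) x) (x : M) : ℝ :=
  let e := chartAt (EuclideanSpace ℝ (Fin d)) x
  (chartCoeff μ e (e x))⁻¹ *
    ∑ i : Fin d, fderiv ℝ (fun y => chartCoeff μ e y * chartComponent e v i y) (e x)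
      (EuclideanSpace.single i (1 : ℝ))

/-- The `n`-form `f i_ξ μ`, for a function `f` and a vector field `ξ`. -/
def contractForm {n : ℕ} {M : Type*} [TopologicalSpace M]
    [ChartedSpace (EuclideanSpace ℝ (Fin (n + 1))) M] (μ : FormField (n + 1) (n + 1) M) (f : M → ℝ)
    (ξ : (x : M) → TangentSpace (𝓡 (n + 1)) x) : FormField (n + 1) n M :=
  fun x => f x • (μ x).curryLeft (ξ x)

/-- A smooth hypersurface `Γ` of the `(n+1)`-dimensional manifold `M` dividing it into two open
regions `D⁺` and `D⁻`, with `M = D⁺ ∪ Γ ∪ D⁻`. Near each point of `Γ` there is a smooth chart in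
which `D⁺`, `Γ`, `D⁻` are given by `x₀ < 0`, `x₀ = 0`, `x₀ > 0`: `Γ` is a smooth embedded
hypersurface that has `D⁺` on one side and `D⁻` on the other. -/
structure DividingHypersurface (n : ℕ) (M : Type u) [TopologicalSpace M]
    [ChartedSpace (EuclideanSpace ℝ (Fin (n + 1))) M] where
  carrier : Set M
  plus : Set M
  minus : Set M
  isOpen_plus : IsOpen plus
  isOpen_minus : IsOpen minus
  disjoint_plus_minus : Disjoint plus minus
  disjoint_plus_carrier : Disjoint plus carrier
  disjoint_minus_carrier : Disjoint minus carrier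
  union_eq : plus ∪ carrier ∪ minus = univ
  exists_chart : ∀ p ∈ carrier, ∃ e ∈ IsManifold.maximalAtlas (𝓡 (n + 1)) ∞ M, p ∈ e.source ∧
    ∀ q ∈ e.source, (q ∈ plus ↔ e q 0 < 0) ∧ (q ∈ carrier ↔ e q 0 = 0) ∧ (q ∈ minus ↔ 0 < e q 0)

namespace DividingHypersurface

variable {n : ℕ} {M : Type u} [TopologicalSpace M] [ChartedSpace (EuclideanSpace ℝ (Fin (n + 1))) M]
  (Γ : DividingHypersurface n M)

/-- A smooth chart of `M` in which `D⁺`, `Γ`, `D⁻` are given by `x₀ < 0`, `x₀ = 0`, `x₀ > 0`. -/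
def IsAdaptedChart (e : OpenPartialHomeomorph M (EuclideanSpace ℝ (Fin (n + 1)))) : Prop :=
  e ∈ IsManifold.maximalAtlas (𝓡 (n + 1)) ∞ M ∧
    ∀ q ∈ e.source, (q ∈ Γ.plus ↔ e q 0 < 0) ∧ (q ∈ Γ.carrier ↔ e q 0 = 0) ∧
      (q ∈ Γ.minus ↔ 0 < e q 0)

/-- The tangent space `T_x Γ ⊆ T_x M` at a point `x ∈ Γ`: the vectors with `dx₀(w) = 0` in the
adapted charts around `x`. -/
def tangent (x : M) : Submodule ℝ (TangentSpace (𝓡 (n + 1)) x) where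
  carrier := {w | ∀ e, Γ.IsAdaptedChart e → x ∈ e.source →
    (show EuclideanSpace ℝ (Fin (n + 1)) from mfderiv (𝓡 (n + 1)) (𝓡 (n + 1)) e x w) 0 = 0}
  add_mem' := by
    intro a b ha hb e he hx
    have h1 := ha e he hx
    have h2 := hb e he hx
    rw [map_add]
    exact (congrArg₂ (· + ·) h1 h2).trans (add_zero 0)
  zero_mem' := by
    intro e _ _
    rw [map_zero]
    rfl
  smul_mem' := by
    intro c a ha e he hx
    have h1 := ha e he hx
    rw [map_smul]
    exact (congrArg (c * ·) h1).trans (mul_zero c)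

theorem isClosed_carrier : IsClosed Γ.carrier := by
  have h : Γ.carrierᶜ = Γ.plus ∪ Γ.minus := by
    ext x
    have hx : x ∈ Γ.plus ∪ Γ.carrier ∪ Γ.minus := by rw [Γ.union_eq]; trivial
    have h1 : x ∈ Γ.plus → x ∉ Γ.carrier := fun h => disjoint_left.1 Γ.disjoint_plus_carrier h
    have h2 : x ∈ Γ.minus → x ∉ Γ.carrier := fun h => disjoint_left.1 Γ.disjoint_minus_carrier h
    simp only [mem_union, mem_compl_iff] at hx ⊢
    tauto
  exact isOpen_compl_iff.1 (h ▸ Γ.isOpen_plus.union Γ.isOpen_minus)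

/-! ### Functions and vector fields -/

/-- `C^∞(Γ)`; a function on `Γ` is extended by zero to `M`. -/
def SmoothFunction : Submodule ℝ (M → ℝ) where
  carrier := {f | ContMDiffOn (𝓡 (n + 1)) 𝓘(ℝ, ℝ) ∞ f Γ.carrier ∧ ∀ x ∉ Γ.carrier, f x = 0}
  add_mem' := by
    rintro a b ⟨ha, ha'⟩ ⟨hb, hb'⟩
    exact ⟨ha.add hb, fun x hx => by simp [ha' x hx, hb' x hx]⟩
  zero_mem' := ⟨contMDiffOn_const, fun _ _ => rfl⟩
  smul_mem' := by
    rintro c a ⟨ha, ha'⟩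
    exact ⟨(contMDiffOn_const (I' := 𝓘(ℝ, ℝ)) (c := c)).smul ha, fun x hx => by simp [ha' x hx]⟩

/-- `DC^∞(M, Γ)`: pairs `(f⁺, f⁻)` of functions smooth on `D^±` up to the boundary `Γ`, standing for
`χ⁺ f⁺ + χ⁻ f⁻`. Each of `f^±` is extended by zero outside of `D^± ∪ Γ`. -/
def DiscFunction : Submodule ℝ ((M → ℝ) × (M → ℝ)) where
  carrier := {f |
    ContMDiffOn (𝓡 (n + 1)) 𝓘(ℝ, ℝ) ∞ f.1 (Γ.plus ∪ Γ.carrier) ∧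
    ContMDiffOn (𝓡 (n + 1)) 𝓘(ℝ, ℝ) ∞ f.2 (Γ.minus ∪ Γ.carrier) ∧
    (∀ x ∉ Γ.plus ∪ Γ.carrier, f.1 x = 0) ∧ ∀ x ∉ Γ.minus ∪ Γ.carrier, f.2 x = 0}
  add_mem' := by
    rintro a b ⟨h1, h2, h3, h4⟩ ⟨k1, k2, k3, k4⟩
    refine ⟨h1.add k1, h2.add k2, fun x hx => ?_, fun x hx => ?_⟩
    · simp [h3 x hx, k3 x hx]
    · simp [h4 x hx, k4 x hx]
  zero_mem' := ⟨contMDiffOn_const, contMDiffOn_const, fun _ _ => rfl, fun _ _ => rfl⟩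
  smul_mem' := by
    rintro c a ⟨h1, h2, h3, h4⟩
    refine ⟨(contMDiffOn_const (I' := 𝓘(ℝ, ℝ)) (c := c)).smul h1,
      (contMDiffOn_const (I' := 𝓘(ℝ, ℝ)) (c := c)).smul h2, fun x hx => ?_, fun x hx => ?_⟩
    · simp [h3 x hx]
    · simp [h4 x hx]

/-- The combination `χ⁺ a + χ⁻ b`, where `χ^±` are the characteristic functions of `D^±`. -/
def glue {F : M → Type*} [∀ x, Zero (F x)] (a b : (x : M) → F x) (x : M) : F x :=
  open Classical in if x ∈ Γ.plus then a x else if x ∈ Γ.minus then b x else 0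

/-- `jump(f) = f⁺|_Γ - f⁻|_Γ`. -/
def jump (f : Γ.DiscFunction) : Γ.SmoothFunction :=
  ⟨Γ.carrier.indicator (fun x => f.1.1 x - f.1.2 x), by
    obtain ⟨⟨a, b⟩, h1, h2, -, -⟩ := f
    refine ⟨?_, fun x hx => indicator_of_notMem hx _⟩
    exact ((h1.mono subset_union_right).sub (h2.mono subset_union_right)).congr
      (fun x hx => indicator_of_mem hx _)⟩

/-- `DVect(M, Γ)`: pairs `(v⁺, v⁻)` of vector fields smooth on `D^±` up to the boundary `Γ`, standing
for `χ⁺ v⁺ + χ⁻ v⁻`, such that `v⁺ - v⁻` is tangent to `Γ` along `Γ`. Each of `v^±` is extended by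
zero outside of `D^± ∪ Γ`. The fields have compact support, which is no condition if `M` is
compact. -/
def DVect [IsManifold (𝓡 (n + 1)) ∞ M] : Submodule ℝ
    (((x : M) → TangentSpace (𝓡 (n + 1)) x) × ((x : M) → TangentSpace (𝓡 (n + 1)) x)) where
  carrier := {v |
    ContMDiffOn (𝓡 (n + 1)) (𝓡 (n + 1)).tangent ∞
      (fun x => (⟨x, v.1 x⟩ : TangentBundle (𝓡 (n + 1)) M)) (Γ.plus ∪ Γ.carrier) ∧
    ContMDiffOn (𝓡 (n + 1)) (𝓡 (n + 1)).tangent ∞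
      (fun x => (⟨x, v.2 x⟩ : TangentBundle (𝓡 (n + 1)) M)) (Γ.minus ∪ Γ.carrier) ∧
    (∀ x ∉ Γ.plus ∪ Γ.carrier, v.1 x = 0) ∧ (∀ x ∉ Γ.minus ∪ Γ.carrier, v.2 x = 0) ∧
    (∀ x ∈ Γ.carrier, v.1 x - v.2 x ∈ Γ.tangent x) ∧
    ∃ K : Set M, IsCompact K ∧ ∀ x ∉ K, v.1 x = 0 ∧ v.2 x = 0}
  add_mem' := by
    rintro a b ⟨h1, h2, h3, h4, h5, K, hK, h6⟩ ⟨k1, k2, k3, k4, k5, L, hL, k6⟩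
    refine ⟨h1.add_section k1, h2.add_section k2, fun x hx => ?_, fun x hx => ?_, fun x hx => ?_,
      K ∪ L, hK.union hL, fun x hx => ⟨?_, ?_⟩⟩
    · simp [h3 x hx, k3 x hx]
    · simp [h4 x hx, k4 x hx]
    · have := (Γ.tangent x).add_mem (h5 x hx) (k5 x hx)
      rwa [sub_add_sub_comm] at this
    · simp [(h6 x (fun h => hx (Or.inl h))).1, (k6 x (fun h => hx (Or.inr h))).1]
    · simp [(h6 x (fun h => hx (Or.inl h))).2, (k6 x (fun h => hx (Or.inr h))).2]
  zero_mem' := by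
    refine ⟨(contMDiff_zeroSection ℝ (TangentSpace (𝓡 (n + 1)) : M → Type _)).contMDiffOn,
      (contMDiff_zeroSection ℝ (TangentSpace (𝓡 (n + 1)) : M → Type _)).contMDiffOn,
      fun _ _ => rfl, fun _ _ => rfl, fun x _ => ?_, ∅, isCompact_empty, fun _ _ => ⟨rfl, rfl⟩⟩
    simp
  smul_mem' := by
    rintro c a ⟨h1, h2, h3, h4, h5, K, hK, h6⟩
    refine ⟨h1.const_smul_section, h2.const_smul_section, fun x hx => ?_, fun x hx => ?_,
      fun x hx => ?_, K, hK, fun x hx => ⟨?_, ?_⟩⟩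
    · simp [h3 x hx]
    · simp [h4 x hx]
    · have := (Γ.tangent x).smul_mem c (h5 x hx)
      rwa [smul_sub] at this
    · simp [(h6 x hx).1]
    · simp [(h6 x hx).2]

variable [IsManifold (𝓡 (n + 1)) ∞ M]

/-! ### Regularized operators -/

/-- The value `χ⁺ v⁺ + χ⁻ v⁻` of a discontinuous vector field. -/
def fieldValue (v : Γ.DVect) : (x : M) → TangentSpace (𝓡 (n + 1)) x :=
  Γ.glue v.1.1 v.1.2

/-- The value `χ⁺ f⁺ + χ⁻ f⁻` of a discontinuous function. -/
def funValue (f : Γ.DiscFunction) : M → ℝ :=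
  Γ.glue (F := fun _ => ℝ) f.1.1 f.1.2

/-- The regularized differential `d^R f = χ⁺ df⁺ + χ⁻ df⁻`. -/
def dR (f : Γ.DiscFunction) : (x : M) → (TangentSpace (𝓡 (n + 1)) x →L[ℝ] ℝ) :=
  Γ.glue (F := fun x => TangentSpace (𝓡 (n + 1)) x →L[ℝ] ℝ)
    (fun x => mfderiv (𝓡 (n + 1)) 𝓘(ℝ, ℝ) f.1.1 x) (fun x => mfderiv (𝓡 (n + 1)) 𝓘(ℝ, ℝ) f.1.2 x)

/-- The regularized divergence `div^R(v) = χ⁺ div(v⁺) + χ⁻ div(v⁻)`. -/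
def divR (μ : FormField (n + 1) (n + 1) M) (v : Γ.DVect) : M → ℝ :=
  Γ.glue (F := fun _ => ℝ) (divergence μ v.1.1) (divergence μ v.1.2)

/-! ### Integration over `Γ` -/

/-- Charts adapted to `Γ` together with a smooth partition of unity on `Γ` subordinate to them. -/
structure AdaptedPartition where
  index : Type u
  chart : index → OpenPartialHomeomorph M (EuclideanSpace ℝ (Fin (n + 1)))
  adapted : ∀ i, Γ.IsAdaptedChart (chart i)
  weight : SmoothPartitionOfUnity index (𝓡 (n + 1)) M Γ.carrier
  subordinate : weight.IsSubordinate (fun i => (chart i).source)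

/-- Adapted charts with a subordinate partition of unity exist. -/
theorem nonempty_adaptedPartition [T2Space M] [SigmaCompactSpace M] :
    Nonempty Γ.AdaptedPartition := by
  choose e he hp hq using fun p : Γ.carrier => Γ.exists_chart p.1 p.2
  obtain ⟨ρ, hρ⟩ := SmoothPartitionOfUnity.exists_isSubordinate (𝓡 (n + 1)) Γ.isClosed_carrier
    (fun p => (e p).source) (fun p => (e p).open_source)
    (fun x hx => mem_iUnion.2 ⟨⟨x, hx⟩, hp ⟨x, hx⟩⟩)
  exact ⟨⟨Γ.carrier, e, fun p => ⟨he p, hq p⟩, ρ, hρ⟩⟩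

namespace AdaptedPartition

variable {Γ}

/-- The inclusion `y ↦ (0, y)` of the hyperplane `x₀ = 0`. -/
def slice (y : EuclideanSpace ℝ (Fin n)) : EuclideanSpace ℝ (Fin (n + 1)) :=
  WithLp.toLp 2 (Fin.cons (0 : ℝ) (fun i => y i) : Fin (n + 1) → ℝ)

/-- The contribution of the `i`-th chart to `∫_Γ α`, a function on the set of all `y` such that
`(0, y)` lies in the range of the chart. With the parametrization `ψ(y) = e⁻¹(0, y)` of `Γ` this is
`ρ_i(ψ(y)) α(∂₁, …, ∂_n)`, where `∂₁, …, ∂_n` is the coordinate frame of `Γ`, with the sign that says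
whether this frame is positive for the orientation of `Γ` as the boundary of `D⁺`, that is, whether
`μ(∂₀, ∂₁, …, ∂_n) > 0`. Note that `∂₀` points out of `D⁺ = {x₀ < 0}`. -/
def integrand (P : Γ.AdaptedPartition) (μ : FormField (n + 1) (n + 1) M)
    (α : FormField (n + 1) n M) (i : P.index) (y : EuclideanSpace ℝ (Fin n)) : ℝ :=
  P.weight i ((P.chart i).symm (slice y)) * (Real.sign (chartCoeff μ (P.chart i) (slice y)) *
    α ((P.chart i).symm (slice y)) (fun j => coordVector (P.chart i) (slice y) j.succ))

/-- The domain of `y ↦ e⁻¹(0, y)` for the `i`-th chart `e`. -/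
def domain (P : Γ.AdaptedPartition) (i : P.index) : Set (EuclideanSpace ℝ (Fin n)) :=
  {y | slice y ∈ (P.chart i).target}

/-- The integral `∫_Γ α` of an `n`-form over `Γ`, where `Γ` is oriented as the boundary of `D⁺`
and `M` by `μ`. It depends only on the pullback of `α` to `Γ`. -/
def integral (P : Γ.AdaptedPartition) (μ : FormField (n + 1) (n + 1) M)
    (α : FormField (n + 1) n M) : ℝ :=
  ∑ᶠ i, ∫ y in P.domain i, P.integrand μ α i y

/-- The integral `∫_Γ α` makes sense: the form is integrable in the charts, and only finitely many
charts contribute. -/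
def IsIntegrable (P : Γ.AdaptedPartition) (μ : FormField (n + 1) (n + 1) M)
    (α : FormField (n + 1) n M) : Prop :=
  (∀ i, IntegrableOn (P.integrand μ α i) (P.domain i)) ∧
    {i | ∃ y ∈ P.domain i, P.integrand μ α i y ≠ 0}.Finite

end AdaptedPartition

/-! ### The anchor map -/

/-- The anchor `# v`: the normal component of `v⁺` along `Γ`, which is also that of `v⁻`. It is a
normal field `ξ` along `Γ`, the velocity with which `Γ` moves; as an element of
`T_Γ V(M) = Ω^n(Γ)` it is the restriction of `i_ξ μ` to `Γ`. Only its values on `Γ` matter. -/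
def anchor [RiemannianBundle (fun x : M => TangentSpace (𝓡 (n + 1)) x)] (v : Γ.DVect) (x : M) :
    TangentSpace (𝓡 (n + 1)) x :=
  haveI : FiniteDimensional ℝ (TangentSpace (𝓡 (n + 1)) x) :=
    inferInstanceAs (FiniteDimensional ℝ (EuclideanSpace ℝ (Fin (n + 1))))
  orthogonalPart (Γ.tangent x) (v.1.1 x)

/-! ### Pairings -/

/-- The pairing `⟨n, # v⟩ = ∫_Γ n i_{#v} μ` of `n ∈ C^∞(Γ)`, which stands for the cotangent vector
`n ⊗ Dense(Γ)` in `T*_Γ V(M)`, with the tangent vector `# v`. -/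
def anchorPairing [RiemannianBundle (fun x : M => TangentSpace (𝓡 (n + 1)) x)]
    (P : Γ.AdaptedPartition) (μ : FormField (n + 1) (n + 1) M) (f : Γ.SmoothFunction)
    (v : Γ.DVect) : ℝ :=
  P.integral μ (contractForm μ f.1 (Γ.anchor v))

/-- The pairing `⟨m ⊗ μ, v⟩ = ∫_M (i_v m) μ` of a `1`-form density with a discontinuous vector
field. -/
def densityPairing [MeasurableSpace M] (μ : FormField (n + 1) (n + 1) M)
    (m : (x : M) → (TangentSpace (𝓡 (n + 1)) x →L[ℝ] ℝ)) (v : Γ.DVect) : ℝ :=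
  ∫ x, m x (Γ.fieldValue v x) ∂(volMeasure μ)

/-- The pairing `∫_M div^R(v) f μ`. -/
def divergencePairing [MeasurableSpace M] (μ : FormField (n + 1) (n + 1) M)
    (f : Γ.DiscFunction) (v : Γ.DVect) : ℝ :=
  ∫ x, Γ.divR μ v x * Γ.funValue f x ∂(volMeasure μ)

end DividingHypersurface

end

/-! On each side of `Γ` the Leibniz rule reads `dh(v) + h div(v) = div(h v)`, so `(d^R h + T^R h) ⊗
μ` evaluated at `v` is the integral of `div(h⁺ v⁺)` over `D⁺` plus that of `div(h⁻ v⁻)` over `D⁻`.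
By the divergence theorem the first is the flux of `h⁺ v⁺` through `Γ` and the second is minus the
flux of `h⁻ v⁻`, because `Γ` is oriented as the boundary of `D⁺`. The flux of a field through `Γ`
sees only its component transverse to `Γ`. Since `v⁺ - v⁻` is tangent and `#v` differs from `v⁺` by
a tangent vector, the three fields `v⁺`, `v⁻`, `#v` have the same flux density. What remains is the
integral of `(h⁺ - h⁻) i_{#v} μ` over `Γ`, that is, the pairing of `jump(h)` with `#v`; this is
`anchorPairing_jump`. As every smooth function on `Γ` is a jump (`exists_jump_eq`), the identity
also yields convergence, linearity and independence of the choice of `h`.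

Most of the work is the divergence theorem on a region with smooth boundary. The divergence is
independent of the chart (`coordDivergence_transition`), integrals against `volMeasure` are computed
in any chart (`setIntegral_volMeasure`), and on a half-space the divergence theorem for boxes
applies (`integral_halfSpace_divergence`). Partitions of unity globalize this: one on `M` gives
integrability, and one along `Γ` gives the boundary term (`integral_divergence_eq_sum`). -/

noncomputable section

/-! ### Change of charts for tangent vectors and volume forms -/

section Charts

variable {d : ℕ} {M : Type u} [TopologicalSpace M] [ChartedSpace (EuclideanSpace ℝ (Fin d)) M]
  {e e' : OpenPartialHomeomorph M (EuclideanSpace ℝ (Fin d))}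

/-- The coordinate expression of a vector field in the chart `e`. -/
def chartVec {d : ℕ} {M : Type*} [TopologicalSpace M]
    [ChartedSpace (EuclideanSpace ℝ (Fin d)) M]
    (e : OpenPartialHomeomorph M (EuclideanSpace ℝ (Fin d)))
    (v : (x : M) → TangentSpace (𝓡 d) x) (y : EuclideanSpace ℝ (Fin d)) :
    EuclideanSpace ℝ (Fin d) :=
  mfderiv (𝓡 d) (𝓡 d) e (e.symm y) (v (e.symm y))

theorem mdifferentiable_of_mem_maximalAtlas (he : e ∈ IsManifold.maximalAtlas (𝓡 d) ∞ M) :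
    e.MDifferentiable (𝓡 d) (𝓡 d) :=
  ⟨(contMDiffOn_of_mem_maximalAtlas he).mdifferentiableOn (by simp),
    (contMDiffOn_symm_of_mem_maximalAtlas he).mdifferentiableOn (by simp)⟩

theorem contDiffOn_transition (he : e ∈ IsManifold.maximalAtlas (𝓡 d) ∞ M)
    (he' : e' ∈ IsManifold.maximalAtlas (𝓡 d) ∞ M) :
    ContDiffOn ℝ ∞ (e' ∘ e.symm) (e.target ∩ e.symm ⁻¹' e'.source) :=
  ((contMDiffOn_of_mem_maximalAtlas he').comp
    ((contMDiffOn_symm_of_mem_maximalAtlas he).mono inter_subset_left)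
    (fun _ hy => hy.2)).contDiffOn

theorem isOpen_transition_domain {M E : Type*} [TopologicalSpace M] [TopologicalSpace E]
    (e e' : OpenPartialHomeomorph M E) :
    IsOpen (e.target ∩ e.symm ⁻¹' e'.source) :=
  e.symm.isOpen_inter_preimage e'.open_source

theorem contDiffAt_transition (he : e ∈ IsManifold.maximalAtlas (𝓡 d) ∞ M)
    (he' : e' ∈ IsManifold.maximalAtlas (𝓡 d) ∞ M) {y : EuclideanSpace ℝ (Fin d)}
    (hy : y ∈ e.target) (hy' : e.symm y ∈ e'.source) : ContDiffAt ℝ ∞ (e' ∘ e.symm) y :=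
  (contDiffOn_transition he he').contDiffAt ((isOpen_transition_domain e e').mem_nhds ⟨hy, hy'⟩)

/-- The differential of a chart, as an isomorphism from the tangent space to the model space. -/
def chartEquiv (he : e ∈ IsManifold.maximalAtlas (𝓡 d) ∞ M) {x : M} (hx : x ∈ e.source) :
    TangentSpace (𝓡 d) x ≃L[ℝ] EuclideanSpace ℝ (Fin d) :=
  (mdifferentiable_of_mem_maximalAtlas he).mfderiv hx

theorem chartEquiv_apply (he : e ∈ IsManifold.maximalAtlas (𝓡 d) ∞ M) {x : M} (hx : x ∈ e.source)
    (w : TangentSpace (𝓡 d) x) : chartEquiv he hx w = mfderiv (𝓡 d) (𝓡 d) e x w := rfl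

/-- Chain rule for `e' = (e' ∘ e.symm) ∘ e`, which holds near `x`. -/
theorem chartEquiv_transition (he : e ∈ IsManifold.maximalAtlas (𝓡 d) ∞ M)
    (he' : e' ∈ IsManifold.maximalAtlas (𝓡 d) ∞ M) {x : M} (hx : x ∈ e.source)
    (hx' : x ∈ e'.source) (w : TangentSpace (𝓡 d) x) :
    chartEquiv he' hx' w = fderiv ℝ (e' ∘ e.symm) (e x) (chartEquiv he hx w) := by
  have h1 := (mdifferentiable_of_mem_maximalAtlas he).mdifferentiableAt hx
  have h2 : MDifferentiableAt (𝓡 d) (𝓡 d) (e' ∘ e.symm) (e x) :=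
    ((contDiffAt_transition he he' (e.map_source hx)
      (by rwa [e.left_inv hx])).differentiableAt (by simp)).mdifferentiableAt
  have h3 : mfderiv (𝓡 d) (𝓡 d) e' x = mfderiv (𝓡 d) (𝓡 d) ((e' ∘ e.symm) ∘ e) x := by
    apply Filter.EventuallyEq.mfderiv_eq
    filter_upwards [e.open_source.mem_nhds hx] with z hz
    simp [e.left_inv hz]
  rw [chartEquiv_apply, chartEquiv_apply, h3, mfderiv_comp x h2 h1, mfderiv_eq_fderiv]
  rfl

theorem coordVector_eq (he : e ∈ IsManifold.maximalAtlas (𝓡 d) ∞ M) {y : EuclideanSpace ℝ (Fin d)}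
    (hy : y ∈ e.target) (j : Fin d) :
    coordVector e y j =
      (chartEquiv he (e.map_target hy)).symm (EuclideanSpace.single j (1 : ℝ)) := by
  rw [ContinuousLinearEquiv.eq_symm_apply]
  have := congrArg (fun L => L (EuclideanSpace.single j (1 : ℝ)))
    ((mdifferentiable_of_mem_maximalAtlas he).comp_symm_deriv hy)
  exact this

theorem chartVec_eq (he : e ∈ IsManifold.maximalAtlas (𝓡 d) ∞ M) {y : EuclideanSpace ℝ (Fin d)}
    (hy : y ∈ e.target) (v : (x : M) → TangentSpace (𝓡 d) x) :
    chartVec e v y = chartEquiv he (e.map_target hy) (v (e.symm y)) := rfl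

theorem chartVec_transition (he : e ∈ IsManifold.maximalAtlas (𝓡 d) ∞ M)
    (he' : e' ∈ IsManifold.maximalAtlas (𝓡 d) ∞ M) (v : (x : M) → TangentSpace (𝓡 d) x)
    {y : EuclideanSpace ℝ (Fin d)} (hy : y ∈ e.target) (hy' : e.symm y ∈ e'.source) :
    chartVec e' v ((e' ∘ e.symm) y) = fderiv ℝ (e' ∘ e.symm) y (chartVec e v y) := by
  have h := chartEquiv_transition he he' (e.map_target hy) hy' (v (e.symm y))
  rw [e.right_inv hy] at h
  rw [chartVec_eq he hy, ← h]
  change mfderiv (𝓡 d) (𝓡 d) e' (e'.symm (e' (e.symm y))) (v (e'.symm (e' (e.symm y)))) = _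
  rw [e'.left_inv hy']
  rfl

/-- A form of top degree is a multiple of the determinant of any basis, so a linear map scales it by
its own determinant. -/
theorem AlternatingMap.map_comp_basis_eq {V ι : Type*} [Fintype ι] [DecidableEq ι]
    [AddCommGroup V] [Module ℝ V]
    (b : Module.Basis ι ℝ V) (η : V [⋀^ι]→ₗ[ℝ] ℝ) (A : V →ₗ[ℝ] V) :
    η (fun i => A (b i)) = η b * LinearMap.det A := by
  have h := η.eq_smul_basis_det b
  have h2 : b.det (fun i => A (b i)) = LinearMap.det A := by
    have := b.det_comp A b
    rw [b.det_self, mul_one] at this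
    exact this
  conv_lhs => rw [h]
  rw [AlternatingMap.smul_apply, h2, smul_eq_mul]

theorem chartCoeff_transition (he : e ∈ IsManifold.maximalAtlas (𝓡 d) ∞ M)
    (he' : e' ∈ IsManifold.maximalAtlas (𝓡 d) ∞ M) (μ : FormField d d M)
    {y : EuclideanSpace ℝ (Fin d)} (hy : y ∈ e.target) (hy' : e.symm y ∈ e'.source) :
    chartCoeff μ e y =
      chartCoeff μ e' ((e' ∘ e.symm) y) * (fderiv ℝ (e' ∘ e.symm) y).det := by
  -- Stated at a point `x` of `M` rather than at `e.symm y`, so that both frames lie in one tangent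
  -- space and no transport between equal base points is needed.
  have key : ∀ x : M, ∀ hx : x ∈ e.source, ∀ hx' : x ∈ e'.source,
      μ x (fun j => (chartEquiv he hx).symm (EuclideanSpace.single j (1 : ℝ))) =
      μ x (fun j => (chartEquiv he' hx').symm (EuclideanSpace.single j (1 : ℝ))) *
        (fderiv ℝ (e' ∘ e.symm) (e x)).det := by
    intro x hx hx'
    have h := AlternatingMap.map_comp_basis_eq (EuclideanSpace.basisFun (Fin d) ℝ).toBasis
      ((μ x).compLinearMap (chartEquiv he' hx').symm.toLinearEquiv.toLinearMap)
      (fderiv ℝ (e' ∘ e.symm) (e x)).toLinearMap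
    simp only [AlternatingMap.compLinearMap_apply, OrthonormalBasis.coe_toBasis,
      EuclideanSpace.basisFun_apply] at h
    refine Eq.trans ?_ h
    congr 1
    funext j
    have h2 := chartEquiv_transition he he' hx hx'
      ((chartEquiv he hx).symm (EuclideanSpace.single j (1 : ℝ)))
    rw [ContinuousLinearEquiv.apply_symm_apply] at h2
    exact ((chartEquiv he' hx').symm_apply_eq.2 h2.symm).symm
  have h1 : chartCoeff μ e y = μ (e.symm y)
      (fun j => (chartEquiv he (e.map_target hy)).symm (EuclideanSpace.single j (1 : ℝ))) :=
    congrArg _ (funext fun j => coordVector_eq he hy j)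
  have h2 : ∀ x : M, ∀ hx' : x ∈ e'.source, chartCoeff μ e' (e' x) = μ x
      (fun j => (chartEquiv he' hx').symm (EuclideanSpace.single j (1 : ℝ))) := by
    intro x hx'
    have h3 : chartCoeff μ e' (e' x) = μ (e'.symm (e' x)) (fun j => (chartEquiv he'
        (e'.map_target (e'.map_source hx'))).symm (EuclideanSpace.single j (1 : ℝ))) :=
      congrArg _ (funext fun j => coordVector_eq he' (e'.map_source hx') j)
    rw [h3]
    have h4 : e'.symm (e' x) = x := e'.left_inv hx'
    have : ∀ z (hz : z ∈ e'.source), z = x →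
        μ z (fun j => (chartEquiv he' hz).symm (EuclideanSpace.single j (1 : ℝ))) = 
        μ x (fun j => (chartEquiv he' hx').symm (EuclideanSpace.single j (1 : ℝ))) := by
      rintro z hz rfl; rfl
    exact this _ _ h4
  rw [h1, Function.comp_apply, h2 _ hy', key _ (e.map_target hy) hy', e.right_inv hy]

/-- The value `±1` on an orthonormal frame makes the form nonzero at the point, and a nonzero form
of top degree vanishes on no basis, in particular not on the coordinate frame. -/
theorem IsRiemannianVolumeForm.chartCoeff_ne_zero
    [RiemannianBundle (fun x : M => TangentSpace (𝓡 d) x)] {μ : FormField d d M}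
    (hμ : IsRiemannianVolumeForm μ) (he : e ∈ IsManifold.maximalAtlas (𝓡 d) ∞ M)
    {y : EuclideanSpace ℝ (Fin d)} (hy : y ∈ e.target) : chartCoeff μ e y ≠ 0 := by
  have hx := e.map_target hy
  have : FiniteDimensional ℝ (TangentSpace (𝓡 d) (e.symm y)) :=
    inferInstanceAs (FiniteDimensional ℝ (EuclideanSpace ℝ (Fin d)))
  have hd : Module.finrank ℝ (TangentSpace (𝓡 d) (e.symm y)) = d := by
    rw [(chartEquiv he hx).toLinearEquiv.finrank_eq]; simp
  let b := (stdOrthonormalBasis ℝ (TangentSpace (𝓡 d) (e.symm y))).reindex (finCongr hd)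
  have hb := hμ.abs_eq_one (e.symm y) b b.orthonormal
  have hne : μ (e.symm y) ≠ 0 := by
    intro h0
    rw [h0] at hb
    simp at hb
  let c : Module.Basis (Fin d) ℝ (TangentSpace (𝓡 d) (e.symm y)) :=
    (EuclideanSpace.basisFun (Fin d) ℝ).toBasis.map (chartEquiv he hx).symm.toLinearEquiv
  have hc := (AlternatingMap.map_basis_ne_zero_iff c (μ (e.symm y))).2 hne
  have : chartCoeff μ e y = μ (e.symm y) c := by
    refine congrArg _ (funext fun j => ?_)
    rw [coordVector_eq he hy j]
    simp only [c, Module.Basis.map_apply, OrthonormalBasis.coe_toBasis,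
      EuclideanSpace.basisFun_apply]
    rfl
  rwa [this]

end Charts

/-! ### Invariance of the divergence under a change of coordinates -/

section CoordinateDivergence

variable {d : ℕ}

local notation "𝔼" => EuclideanSpace ℝ (Fin d)

theorem ContinuousLinearMap.det_eq_matrix_det (L : 𝔼 →L[ℝ] 𝔼) :
    L.det = (Matrix.of fun i j => L (EuclideanSpace.single j 1) i).det := by
  rw [ContinuousLinearMap.det, ← LinearMap.det_toMatrix (EuclideanSpace.basisFun (Fin d) ℝ).toBasis]
  congr 1

theorem LinearMap.trace_eq_sum_euclidean (L : 𝔼 →ₗ[ℝ] 𝔼) :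
    LinearMap.trace ℝ 𝔼 L = ∑ i, L (EuclideanSpace.single i 1) i := by
  rw [LinearMap.trace_eq_matrix_trace ℝ (EuclideanSpace.basisFun (Fin d) ℝ).toBasis, Matrix.trace]
  simp [LinearMap.toMatrix_apply]

/-- By the Leibniz expansion the determinant is a polynomial in the matrix entries, which are
continuous linear in `L`. -/
theorem differentiable_det : Differentiable ℝ (fun L : 𝔼 →L[ℝ] 𝔼 => L.det) := by
  have h : (fun L : 𝔼 →L[ℝ] 𝔼 => L.det) = fun L => ∑ σ : Equiv.Perm (Fin d),
      (Equiv.Perm.sign σ : ℝ) * ∏ i, L (EuclideanSpace.single i 1) (σ i) := by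
    funext L
    rw [ContinuousLinearMap.det_eq_matrix_det, Matrix.det_apply']
    simp
  rw [h]
  have h2 : ∀ i j : Fin d,
      Differentiable ℝ (fun L : 𝔼 →L[ℝ] 𝔼 => L (EuclideanSpace.single i 1) j) := by
    intro i j
    exact ((EuclideanSpace.proj j : 𝔼 →L[ℝ] ℝ).comp
      (ContinuousLinearMap.apply ℝ 𝔼 (EuclideanSpace.single i 1 : 𝔼))).differentiable
  fun_prop

/-- The derivative exists, so it can be read off along the line `id + t N`, where `det (1 + t P) = 1
+ t tr P + O(t²)`. -/
theorem fderiv_det_id (N : 𝔼 →L[ℝ] 𝔼) :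
    fderiv ℝ (fun L : 𝔼 →L[ℝ] 𝔼 => L.det) (ContinuousLinearMap.id ℝ 𝔼) N =
      LinearMap.trace ℝ 𝔼 N.toLinearMap := by
  have h1 : HasDerivAt (fun t : ℝ => (ContinuousLinearMap.id ℝ 𝔼 + t • N).det)
      (fderiv ℝ (fun L : 𝔼 →L[ℝ] 𝔼 => L.det) (ContinuousLinearMap.id ℝ 𝔼) N) 0 := by
    have hl : HasDerivAt (fun t : ℝ => ContinuousLinearMap.id ℝ 𝔼 + t • N) N 0 := by
      simpa using ((hasDerivAt_id (0 : ℝ)).smul_const N).const_add (ContinuousLinearMap.id ℝ 𝔼)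
    have h0 : ContinuousLinearMap.id ℝ 𝔼 + (0 : ℝ) • N = ContinuousLinearMap.id ℝ 𝔼 := by
      ext1 u; simp
    have h3 := (differentiable_det (d := d) (ContinuousLinearMap.id ℝ 𝔼)).hasFDerivAt
    exact HasFDerivAt.comp_hasDerivAt (f := fun t : ℝ => ContinuousLinearMap.id ℝ 𝔼 + t • N)
      (0 : ℝ) (by rw [h0]; exact h3) hl
  let P : Matrix (Fin d) (Fin d) ℝ :=
    LinearMap.toMatrix (EuclideanSpace.basisFun (Fin d) ℝ).toBasis
      (EuclideanSpace.basisFun (Fin d) ℝ).toBasis N.toLinearMap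
  obtain ⟨q, hq⟩ : ∃ q : Polynomial ℝ, ∀ t : ℝ, (1 + t • P).det =
      1 + P.trace * t + q.eval t * t ^ 2 := ⟨_, fun t => Matrix.det_one_add_smul t P⟩
  have h2 : (fun t : ℝ => (ContinuousLinearMap.id ℝ 𝔼 + t • N).det) =
      fun t => 1 + P.trace * t + q.eval t * t ^ 2 := by
    funext t
    rw [← hq, ContinuousLinearMap.det,
      ← LinearMap.det_toMatrix (EuclideanSpace.basisFun (Fin d) ℝ).toBasis]
    congr 1
    have : ((ContinuousLinearMap.id ℝ 𝔼 + t • N : 𝔼 →L[ℝ] 𝔼) : 𝔼 →ₗ[ℝ] 𝔼) =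
        LinearMap.id + t • N.toLinearMap := rfl
    rw [this, map_add, map_smul, LinearMap.toMatrix_id]
  have h3 : HasDerivAt (fun t : ℝ => 1 + P.trace * t + q.eval t * t ^ 2) P.trace 0 := by
    have := (((hasDerivAt_id (0 : ℝ)).const_mul P.trace).const_add 1).add
      ((q.hasDerivAt 0).mul ((hasDerivAt_id (0 : ℝ)).pow 2))
    simpa using! this
  rw [h2] at h1
  rw [h1.unique h3, LinearMap.trace_eq_matrix_trace ℝ (EuclideanSpace.basisFun (Fin d) ℝ).toBasis]

/-- The divergence `r⁻¹ ∑ᵢ ∂ᵢ(r wᵢ)` of a vector field on Euclidean space with respect to the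
density `r`. -/
def coordDivergence (r : 𝔼 → ℝ) (w : 𝔼 → 𝔼) (y : 𝔼) : ℝ :=
  (r y)⁻¹ * ∑ i, fderiv ℝ (fun z => r z * w z i) y (EuclideanSpace.single i 1)

theorem sum_apply_single_mul (L : 𝔼 →L[ℝ] ℝ) (w : 𝔼) :
    ∑ i, L (EuclideanSpace.single i 1) * w i = L w := by
  conv_rhs => rw [← (EuclideanSpace.basisFun (Fin d) ℝ).sum_repr w]
  simp [map_sum, mul_comm]

/-- The product rule separates the logarithmic derivative of the density from the trace of `Dw`. In
this form both parts can be transformed separately. -/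
theorem coordDivergence_eq {r : 𝔼 → ℝ} {w : 𝔼 → 𝔼} {y : 𝔼} (hr : DifferentiableAt ℝ r y)
    (hw : DifferentiableAt ℝ w y) (h0 : r y ≠ 0) :
    coordDivergence r w y =
      (r y)⁻¹ * fderiv ℝ r y (w y) + LinearMap.trace ℝ 𝔼 (fderiv ℝ w y).toLinearMap := by
  have h1 : ∀ i, fderiv ℝ (fun z => r z * w z i) y (EuclideanSpace.single i 1) =
      r y * (fderiv ℝ w y (EuclideanSpace.single i 1)) i +
        fderiv ℝ r y (EuclideanSpace.single i 1) * w y i := by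
    intro i
    have hwi : HasFDerivAt (fun z => w z i)
        ((EuclideanSpace.proj i : 𝔼 →L[ℝ] ℝ).comp (fderiv ℝ w y)) y :=
      (EuclideanSpace.proj i : 𝔼 →L[ℝ] ℝ).hasFDerivAt.comp y hw.hasFDerivAt
    have := (hr.hasFDerivAt.mul hwi).fderiv
    refine (congrArg (fun L => L (EuclideanSpace.single i 1)) this).trans ?_
    simp [mul_comm]
  rw [coordDivergence, Finset.sum_congr rfl fun i _ => h1 i, Finset.sum_add_distrib,
    sum_apply_single_mul, ← Finset.mul_sum, LinearMap.trace_eq_sum_euclidean, mul_add,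
    inv_mul_cancel_left₀ h0, add_comm]
  rfl

/-- The divergence is invariant under a change of coordinates `τ`. -/
theorem coordDivergence_transition {r r' : 𝔼 → ℝ} {w w' : 𝔼 → 𝔼} {τ : 𝔼 → 𝔼} {y : 𝔼}
    (hτ : ContDiffAt ℝ 2 τ y) (hdet : (fderiv ℝ τ y).det ≠ 0)
    (hr' : DifferentiableAt ℝ r' (τ y)) (h0 : r' (τ y) ≠ 0)
    (hw : DifferentiableAt ℝ w y) (hw' : DifferentiableAt ℝ w' (τ y))
    (hr : ∀ᶠ z in 𝓝 y, r z = r' (τ z) * (fderiv ℝ τ z).det)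
    (hww : ∀ᶠ z in 𝓝 y, w' (τ z) = fderiv ℝ τ z (w z)) :
    coordDivergence r w y = coordDivergence r' w' (τ y) := by
  set A : 𝔼 → 𝔼 →L[ℝ] 𝔼 := fderiv ℝ τ with hA
  have hAd : DifferentiableAt ℝ A y :=
    (hτ.fderiv_right (m := 1) (by norm_num)).differentiableAt (by norm_num)
  have hτd : HasFDerivAt τ (A y) y := (hτ.differentiableAt (by norm_num)).hasFDerivAt
  -- Symmetry of the second derivative of `τ` is the heart of the matter: it identifies the extra
  -- term in `Dw'` with the one coming from the derivative of the Jacobian.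
  have hsymm : ∀ u v, fderiv ℝ A y u v = fderiv ℝ A y v u :=
    fun u v => (hτ.isSymmSndFDerivAt (by simp)) u v
  let B : 𝔼 ≃L[ℝ] 𝔼 := (A y).toContinuousLinearEquivOfDetNeZero hdet
  have hB : ∀ u, B u = A y u := fun u => rfl
  -- the derivative of the determinant
  have hdetA : HasFDerivAt (fun z => (A z).det) ((A y).det •
      ((fderiv ℝ (fun L : 𝔼 →L[ℝ] 𝔼 => L.det) (ContinuousLinearMap.id ℝ 𝔼)).comp
        (((ContinuousLinearMap.compL ℝ 𝔼 𝔼 𝔼) B.symm.toContinuousLinearMap).comp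
          (fderiv ℝ A y)))) y := by
    -- Factoring out the constant map `A y` moves the base point to the identity, where the
    -- derivative of the determinant is the trace.
    have e1 : (fun z => (A z).det) =
        fun z => (A y).det * (B.symm.toContinuousLinearMap.comp (A z)).det := by
      funext z
      have : A z = (A y).comp (B.symm.toContinuousLinearMap.comp (A z)) := by
        ext1 u
        exact (B.apply_symm_apply (A z u)).symm
      conv_lhs => rw [this]
      exact LinearMap.det_comp _ _
    rw [e1]
    have e2 : B.symm.toContinuousLinearMap.comp (A y) = ContinuousLinearMap.id ℝ 𝔼 := by
      ext1 u
      exact B.symm_apply_apply u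
    have e3 : HasFDerivAt (fun z => B.symm.toContinuousLinearMap.comp (A z))
        (((ContinuousLinearMap.compL ℝ 𝔼 𝔼 𝔼) B.symm.toContinuousLinearMap).comp
          (fderiv ℝ A y)) y :=
      ((ContinuousLinearMap.compL ℝ 𝔼 𝔼 𝔼) B.symm.toContinuousLinearMap).hasFDerivAt.comp y
        hAd.hasFDerivAt
    have e4 := (differentiable_det (d := d)
      (B.symm.toContinuousLinearMap.comp (A y))).hasFDerivAt
    rw [e2] at e4
    have e5 := HasFDerivAt.comp (f := fun z => B.symm.toContinuousLinearMap.comp (A z)) y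
      (by rw [e2]; exact e4) e3
    exact e5.const_mul _
  have hrc : HasFDerivAt (fun z => r' (τ z)) ((fderiv ℝ r' (τ y)).comp (A y)) y :=
    hr'.hasFDerivAt.comp y hτd
  have hrd := (hrc.mul hdetA).congr_of_eventuallyEq hr
  have hwc : HasFDerivAt (fun z => w' (τ z)) ((fderiv ℝ w' (τ y)).comp (A y)) y :=
    hw'.hasFDerivAt.comp y hτd
  have hwA := (hAd.hasFDerivAt.clm_apply hw.hasFDerivAt).congr_of_eventuallyEq hww
  have hDw' : ∀ u, fderiv ℝ w' (τ y) (A y u) = A y (fderiv ℝ w y u) + fderiv ℝ A y u (w y) := by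
    intro u
    have := congrArg (fun L => L u) (hwc.unique hwA)
    simpa using this
  have hr0 : r y = r' (τ y) * (A y).det := hr.self_of_nhds
  have hw0 : w' (τ y) = A y (w y) := hww.self_of_nhds
  -- Conjugation by `A y` preserves the trace. The remaining term `tr (A⁻¹ DA(w))` is exactly what
  -- the Jacobian factor contributes to the logarithmic derivative of `r`.
  have htr : LinearMap.trace ℝ 𝔼 (fderiv ℝ w' (τ y)).toLinearMap =
      LinearMap.trace ℝ 𝔼 (fderiv ℝ w y).toLinearMap +
      LinearMap.trace ℝ 𝔼 (B.symm.toContinuousLinearMap.comp (fderiv ℝ A y (w y))).toLinearMap := by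
    rw [← LinearMap.trace_conj' (fderiv ℝ w' (τ y)).toLinearMap B.symm.toLinearEquiv, ← map_add]
    congr 1
    ext1 u
    change B.symm (fderiv ℝ w' (τ y) (A y u)) = fderiv ℝ w y u + B.symm (fderiv ℝ A y (w y) u)
    rw [hDw', map_add, hsymm u (w y), ← hB, B.symm_apply_apply]
  rw [coordDivergence_eq hrd.differentiableAt hw (by rw [hr0]; exact mul_ne_zero h0 hdet),
    coordDivergence_eq hr' hw' h0, hrd.fderiv, htr, hr0, hw0]
  have hk := fderiv_det_id (B.symm.toContinuousLinearMap.comp (fderiv ℝ A y (w y)))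
  simp only [add_apply, smul_apply, smul_eq_mul,
    ContinuousLinearMap.comp_apply, ContinuousLinearMap.compL_apply] at hk ⊢
  rw [hk]
  field_simp
  ring

end CoordinateDivergence

/-! ### Smooth vector fields and the divergence on the manifold -/

section Fields

variable {d : ℕ} {M : Type u} [TopologicalSpace M] [ChartedSpace (EuclideanSpace ℝ (Fin d)) M]
  {e : OpenPartialHomeomorph M (EuclideanSpace ℝ (Fin d))}
  {w w' : (x : M) → TangentSpace (𝓡 d) x} {S U : Set M} {x : M} {f : M → ℝ}
  {μ : FormField d d M}

theorem chartVec_add (y : EuclideanSpace ℝ (Fin d)) :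
    chartVec e (w + w') y = chartVec e w y + chartVec e w' y := by
  simp only [chartVec, Pi.add_apply, map_add]
  rfl

theorem chartVec_smul (y : EuclideanSpace ℝ (Fin d)) :
    chartVec e (f • w) y = f (e.symm y) • chartVec e w y := by
  simp only [chartVec, Pi.smul_apply', map_smul]
  rfl

theorem divergence_eq_zero_of_eventually (h : ∀ᶠ z in 𝓝 x, w z = 0) : divergence μ w x = 0 := by
  have hxc := mem_chart_source (EuclideanSpace ℝ (Fin d)) x
  set c := chartAt (EuclideanSpace ℝ (Fin d)) x
  have h0 : divergence μ w x = coordDivergence (chartCoeff μ c) (chartVec c w) (c x) := rfl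
  have h1 : ∀ᶠ y in 𝓝 (c x), chartVec c w y = 0 := by
    have := (c.continuousAt_symm (c.map_source hxc)).eventually
      (by rw [c.left_inv hxc]; exact h)
    filter_upwards [this] with y hy
    rw [chartVec, hy, map_zero]
    rfl
  rw [h0, coordDivergence]
  refine mul_eq_zero_of_right _ (Finset.sum_eq_zero fun i _ => ?_)
  have h2 : (fun z => chartCoeff μ c z * chartVec c w z i) =ᶠ[𝓝 (c x)] fun _ => 0 := by
    filter_upwards [h1] with y hy
    simp [hy]
  rw [h2.fderiv_eq]
  simp

theorem IsRiemannianVolumeForm.differentiableAt_chartCoeff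
    [RiemannianBundle (fun x : M => TangentSpace (𝓡 d) x)] (hμ : IsRiemannianVolumeForm μ)
    (he : e ∈ IsManifold.maximalAtlas (𝓡 d) ∞ M) {y : EuclideanSpace ℝ (Fin d)}
    (hy : y ∈ e.target) : DifferentiableAt ℝ (chartCoeff μ e) y :=
  ((hμ.smooth e he).contDiffAt (e.open_target.mem_nhds hy)).differentiableAt (by simp)

/-- The differential of a function, as a linear form. -/
def scalarDifferential (f : M → ℝ) (x : M) : TangentSpace (𝓡 d) x →L[ℝ] ℝ :=
  mfderiv (𝓡 d) 𝓘(ℝ, ℝ) f x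

theorem mfderiv_eq_fderiv_chart (hf : ContMDiffOn (𝓡 d) 𝓘(ℝ, ℝ) ∞ f U) (hU : U ∈ 𝓝 x)
    (he : e ∈ IsManifold.maximalAtlas (𝓡 d) ∞ M) (hx : x ∈ e.source) :
    DifferentiableAt ℝ (f ∘ e.symm) (e x) ∧ 
    fderiv ℝ (f ∘ e.symm) (e x) (chartVec e w (e x)) = scalarDifferential f x (w x) := by
  have h0 : ContMDiffAt (𝓡 d) 𝓘(ℝ, ℝ) ∞ f x := hf.contMDiffAt hU
  have h1 : ContMDiffAt (𝓡 d) 𝓘(ℝ, ℝ) ∞ (f ∘ e.symm) (e x) := by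
    refine ContMDiffAt.comp (I' := 𝓡 d) (e x) ?_
      (contMDiffAt_symm_of_mem_maximalAtlas he (e.map_source hx))
    rwa [e.left_inv hx]
  have h2 : MDifferentiableAt (𝓡 d) 𝓘(ℝ, ℝ) (f ∘ e.symm) (e x) := h1.mdifferentiableAt (by simp)
  refine ⟨h1.contDiffAt.differentiableAt (by simp), ?_⟩
  have h3 : mfderiv (𝓡 d) 𝓘(ℝ, ℝ) f x = mfderiv (𝓡 d) 𝓘(ℝ, ℝ) ((f ∘ e.symm) ∘ e) x := by
    apply Filter.EventuallyEq.mfderiv_eq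
    filter_upwards [e.open_source.mem_nhds hx] with z hz
    simp [e.left_inv hz]
  rw [scalarDifferential, h3,
    mfderiv_comp x h2 ((mdifferentiable_of_mem_maximalAtlas he).mdifferentiableAt hx),
    mfderiv_eq_fderiv]
  change fderiv ℝ (f ∘ e.symm) (e x)
    (mfderiv (𝓡 d) (𝓡 d) e (e.symm (e x)) (w (e.symm (e x)))) = _
  rw [e.left_inv hx]
  rfl

variable [IsManifold (𝓡 d) ∞ M]

/-- The vector field `w` is smooth on the set `S`. -/
def SmoothFieldOn (w : (x : M) → TangentSpace (𝓡 d) x) (S : Set M) : Prop :=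
  ContMDiffOn (𝓡 d) (𝓡 d).tangent ∞ (fun x => (⟨x, w x⟩ : TangentBundle (𝓡 d) M)) S


/-- The coordinates of `w` are read off from the tangent map of `e`, which is smooth over the open
set `e.source`. The set `S` need not be open, so smoothness up to a boundary passes to coordinates.
-/
theorem SmoothFieldOn.contDiffOn_chartVec (hw : SmoothFieldOn w S)
    (he : e ∈ IsManifold.maximalAtlas (𝓡 d) ∞ M) :
    ContDiffOn ℝ ∞ (chartVec e w) (e.target ∩ e.symm ⁻¹' S) := by
  have h1 : ContMDiffOn (𝓡 d).tangent (𝓡 d).tangent ∞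
      (tangentMapWithin (𝓡 d) (𝓡 d) e e.source)
      (Bundle.TotalSpace.proj ⁻¹' e.source) :=
    (contMDiffOn_of_mem_maximalAtlas he).contMDiffOn_tangentMapWithin (by simp)
      e.open_source.uniqueMDiffOn
  have h2 : ContMDiffOn (𝓡 d) (𝓡 d).tangent ∞
      (fun y => (⟨e.symm y, w (e.symm y)⟩ : TangentBundle (𝓡 d) M))
      (e.target ∩ e.symm ⁻¹' S) :=
    hw.comp ((contMDiffOn_symm_of_mem_maximalAtlas he).mono inter_subset_left) (fun _ hy => hy.2)
  have h3 := h1.comp h2 (fun y hy => e.map_target hy.1)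
  have h4 := (contMDiff_snd_tangentBundle_modelSpace (n := ∞) (EuclideanSpace ℝ (Fin d))
    (𝓡 d)).comp_contMDiffOn h3
  refine h4.contDiffOn.congr fun y hy => ?_
  change mfderiv (𝓡 d) (𝓡 d) e (e.symm y) (w (e.symm y)) =
    mfderivWithin (𝓡 d) (𝓡 d) e e.source (e.symm y) (w (e.symm y))
  rw [mfderivWithin_of_isOpen e.open_source (e.map_target hy.1)]

theorem SmoothFieldOn.differentiableAt_chartVec (hw : SmoothFieldOn w U) (hU : U ∈ 𝓝 x)
    (he : e ∈ IsManifold.maximalAtlas (𝓡 d) ∞ M) (hx : x ∈ e.source) :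
    DifferentiableAt ℝ (chartVec e w) (e x) := by
  refine ((hw.contDiffOn_chartVec he).contDiffAt ?_).differentiableAt (by simp)
  refine Filter.inter_mem (e.open_target.mem_nhds (e.map_source hx)) ?_
  exact (e.continuousAt_symm (e.map_source hx)).preimage_mem_nhds (by rwa [e.left_inv hx])

theorem SmoothFieldOn.add (hw : SmoothFieldOn w S) (hw' : SmoothFieldOn w' S) :
    SmoothFieldOn (w + w') S := ContMDiffOn.add_section hw hw'

theorem SmoothFieldOn.smul (hf : ContMDiffOn (𝓡 d) 𝓘(ℝ, ℝ) ∞ f S) (hw : SmoothFieldOn w S) :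
    SmoothFieldOn (f • w) S := hf.smul_section hw

theorem SmoothFieldOn.const_smul (c : ℝ) (hw : SmoothFieldOn w S) :
    SmoothFieldOn (c • w) S := hw.const_smul_section

variable [RiemannianBundle (fun x : M => TangentSpace (𝓡 d) x)]

/-- The definition uses the preferred chart at `x`, which changes with `x`. Invariance under the
transition map allows a fixed chart on a whole open set. -/
theorem divergence_eq_coordDivergence (hμ : IsRiemannianVolumeForm μ) (hw : SmoothFieldOn w U)
    (hU : U ∈ 𝓝 x) (he : e ∈ IsManifold.maximalAtlas (𝓡 d) ∞ M) (hx : x ∈ e.source) :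
    divergence μ w x = coordDivergence (chartCoeff μ e) (chartVec e w) (e x) := by
  set c := chartAt (EuclideanSpace ℝ (Fin d)) x
  have hc : c ∈ IsManifold.maximalAtlas (𝓡 d) ∞ M := IsManifold.chart_mem_maximalAtlas x
  have hxc : x ∈ c.source := mem_chart_source _ x
  have h0 : divergence μ w x = coordDivergence (chartCoeff μ c) (chartVec c w) (c x) := rfl
  have hτ : (c ∘ e.symm) (e x) = c x := by simp [e.left_inv hx]
  have hdom := isOpen_transition_domain e c
  have hmem : e x ∈ e.target ∩ e.symm ⁻¹' c.source :=
    ⟨e.map_source hx, by simpa [e.left_inv hx] using hxc⟩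
  rw [h0, ← hτ, eq_comm]
  have hdet : (fderiv ℝ (c ∘ e.symm) (e x)).det ≠ 0 := by
    have h1 := chartCoeff_transition he hc μ hmem.1 hmem.2
    intro h2
    rw [h2, mul_zero] at h1
    exact hμ.chartCoeff_ne_zero he hmem.1 h1
  refine coordDivergence_transition
    ((contDiffAt_transition he hc hmem.1 hmem.2).of_le (WithTop.coe_le_coe.2 le_top)) hdet ?_ ?_
    (hw.differentiableAt_chartVec hU he hx) ?_ ?_ ?_
  · rw [hτ]; exact hμ.differentiableAt_chartCoeff hc (c.map_source hxc)
  · rw [hτ]; exact hμ.chartCoeff_ne_zero hc (c.map_source hxc)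
  · rw [hτ]; exact hw.differentiableAt_chartVec hU hc hxc
  · filter_upwards [hdom.mem_nhds hmem] with z hz
    exact chartCoeff_transition he hc μ hz.1 hz.2
  · filter_upwards [hdom.mem_nhds hmem] with z hz
    exact chartVec_transition he hc w hz.1 hz.2

theorem divergence_add (hμ : IsRiemannianVolumeForm μ) (hw : SmoothFieldOn w U)
    (hw' : SmoothFieldOn w' U) (hU : U ∈ 𝓝 x) :
    divergence μ (w + w') x = divergence μ w x + divergence μ w' x := by
  have hc : chartAt (EuclideanSpace ℝ (Fin d)) x ∈ IsManifold.maximalAtlas (𝓡 d) ∞ M :=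
    IsManifold.chart_mem_maximalAtlas x
  have hxc := mem_chart_source (EuclideanSpace ℝ (Fin d)) x
  have hr := hμ.differentiableAt_chartCoeff hc (OpenPartialHomeomorph.map_source _ hxc)
  have h0 := hμ.chartCoeff_ne_zero hc (OpenPartialHomeomorph.map_source _ hxc)
  have h1 := hw.differentiableAt_chartVec hU hc hxc
  have h2 := hw'.differentiableAt_chartVec hU hc hxc
  rw [divergence_eq_coordDivergence hμ hw hU hc hxc, divergence_eq_coordDivergence hμ hw' hU hc hxc,
    divergence_eq_coordDivergence hμ (hw.add hw') hU hc hxc]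
  have h3 : chartVec (chartAt (EuclideanSpace ℝ (Fin d)) x) (w + w') =
      chartVec (chartAt (EuclideanSpace ℝ (Fin d)) x) w +
        chartVec (chartAt (EuclideanSpace ℝ (Fin d)) x) w' := funext fun _ => chartVec_add _
  rw [h3, coordDivergence_eq hr (h1.add h2) h0, coordDivergence_eq hr h1 h0,
    coordDivergence_eq hr h2 h0, fderiv_add h1 h2, Pi.add_apply, map_add,
    ContinuousLinearMap.toLinearMap_add, map_add]
  ring

theorem divergence_smul (hμ : IsRiemannianVolumeForm μ) (hf : ContMDiffOn (𝓡 d) 𝓘(ℝ, ℝ) ∞ f U)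
    (hw : SmoothFieldOn w U) (hU : U ∈ 𝓝 x) :
    divergence μ (f • w) x = f x * divergence μ w x +
      scalarDifferential f x (w x) := by
  have hc : chartAt (EuclideanSpace ℝ (Fin d)) x ∈ IsManifold.maximalAtlas (𝓡 d) ∞ M :=
    IsManifold.chart_mem_maximalAtlas x
  have hxc := mem_chart_source (EuclideanSpace ℝ (Fin d)) x
  have hr := hμ.differentiableAt_chartCoeff hc (OpenPartialHomeomorph.map_source _ hxc)
  have h0 := hμ.chartCoeff_ne_zero hc (OpenPartialHomeomorph.map_source _ hxc)
  have h1 := hw.differentiableAt_chartVec hU hc hxc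
  obtain ⟨h2, h3⟩ := mfderiv_eq_fderiv_chart (w := w) hf hU hc hxc
  rw [divergence_eq_coordDivergence hμ hw hU hc hxc,
    divergence_eq_coordDivergence hμ (SmoothFieldOn.smul hf hw) hU hc hxc, ← h3]
  set c := chartAt (EuclideanSpace ℝ (Fin d)) x
  have h4 : chartVec c (f • w) = (f ∘ c.symm) • chartVec c w :=
    funext fun _ => chartVec_smul _
  have h5 : (f ∘ c.symm) (c x) = f x := by simp [c.left_inv hxc]
  rw [h4, coordDivergence_eq hr (h2.smul h1) h0, coordDivergence_eq hr h1 h0]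
  have h6 := (h2.hasFDerivAt.smul h1.hasFDerivAt).fderiv
  -- The derivative of `f w` is `f Dw` plus the rank-one map `u ↦ df(u) w`, whose trace is `df(w)`.
  have h7 : LinearMap.trace ℝ (EuclideanSpace ℝ (Fin d))
      (fderiv ℝ ((f ∘ c.symm) • chartVec c w) (c x)).toLinearMap =
      f x * LinearMap.trace ℝ (EuclideanSpace ℝ (Fin d)) (fderiv ℝ (chartVec c w) (c x)).toLinearMap
        + fderiv ℝ (f ∘ c.symm) (c x) (chartVec c w (c x)) := by
    rw [← sum_apply_single_mul (fderiv ℝ (f ∘ c.symm) (c x)), LinearMap.trace_eq_sum_euclidean,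
      LinearMap.trace_eq_sum_euclidean, Finset.mul_sum, ← Finset.sum_add_distrib]
    refine Finset.sum_congr rfl fun i _ => ?_
    have := congrArg (fun L => L (EuclideanSpace.single i (1 : ℝ)) i) h6
    refine Eq.trans this ?_
    simp [c.left_inv hxc]
  rw [h7, Pi.smul_apply', h5, map_smul, smul_eq_mul]
  ring

theorem divergence_const_smul (hμ : IsRiemannianVolumeForm μ) (c : ℝ)
    (hw : SmoothFieldOn w U) (hU : U ∈ 𝓝 x) :
    divergence μ (c • w) x = c * divergence μ w x := by
  have := divergence_smul (f := fun _ => c) hμ contMDiffOn_const hw hU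
  rw [scalarDifferential, mfderiv_const] at this
  exact this.trans (add_zero _)

end Fields

/-! ### The volume measure in coordinates -/

section VolumeMeasure

variable {d : ℕ} {M : Type u} [TopologicalSpace M] [ChartedSpace (EuclideanSpace ℝ (Fin d)) M]
  [MeasurableSpace M] [BorelSpace M]
  {e e' : OpenPartialHomeomorph M (EuclideanSpace ℝ (Fin d))} {μ : FormField d d M} {A : Set M}

/-- `e.symm` is controlled only on `e.target`, so measurability is obtained on that subtype and
pushed forward. -/
theorem measurableSet_target_inter_preimage {X Y : Type*} [TopologicalSpace X] [TopologicalSpace Y]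
    [MeasurableSpace X] [BorelSpace X] [MeasurableSpace Y] [BorelSpace Y]
    (e : OpenPartialHomeomorph X Y) {A : Set X} (hA : MeasurableSet A) :
    MeasurableSet (e.target ∩ e.symm ⁻¹' A) := by
  have h : Measurable (e.target.domRestrict e.symm) :=
    (continuousOn_iff_continuous_domRestrict.1 e.continuousOn_symm).measurable
  have h2 := MeasurableSet.subtype_image e.open_target.measurableSet (h hA)
  convert h2 using 1
  ext y
  simp [Set.domRestrict, and_comm]

theorem aemeasurable_symm_target {X Y : Type*} [TopologicalSpace X] [TopologicalSpace Y]
    [MeasurableSpace X] [BorelSpace X] [MeasurableSpace Y] [BorelSpace Y]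
    (e : OpenPartialHomeomorph X Y) (ν : Measure Y) : AEMeasurable e.symm (ν.restrict e.target) :=
  e.continuousOn_symm.aemeasurable e.open_target.measurableSet

theorem aemeasurable_symm_density :
    AEMeasurable e.symm ((volume.restrict e.target).withDensity
      (fun y => ENNReal.ofReal |chartCoeff μ e y|)) :=
  (aemeasurable_symm_target e volume).mono_ac (withDensity_absolutelyContinuous _ _)

theorem chartMeasure_apply (hA : MeasurableSet A) :
    chartMeasure μ e A =
      ∫⁻ y in e.target ∩ e.symm ⁻¹' A, ENNReal.ofReal |chartCoeff μ e y| := by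
  rw [chartMeasure, Measure.map_apply_of_aemeasurable aemeasurable_symm_density hA,
    withDensity_apply', Measure.restrict_restrict' e.open_target.measurableSet, inter_comm]

theorem chartMeasure_inter_source (hA : MeasurableSet A) :
    chartMeasure μ e (A ∩ e.source) = chartMeasure μ e A := by
  rw [chartMeasure_apply hA, chartMeasure_apply (hA.inter e.open_source.measurableSet)]
  congr 2
  ext y
  simp only [mem_inter_iff, mem_preimage]
  exact ⟨fun h => ⟨h.1, h.2.1⟩, fun h => ⟨h.1, h.2, e.map_target h.1⟩⟩

/-- By the change of variables formula, the measures in two charts agree on the overlap. -/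
theorem chartMeasure_eq_of_subset (he : e ∈ IsManifold.maximalAtlas (𝓡 d) ∞ M)
    (he' : e' ∈ IsManifold.maximalAtlas (𝓡 d) ∞ M) (hA : MeasurableSet A) (h : A ⊆ e.source)
    (h' : A ⊆ e'.source) : chartMeasure μ e A = chartMeasure μ e' A := by
  rw [chartMeasure_apply hA, chartMeasure_apply hA]
  have himage : e'.target ∩ e'.symm ⁻¹' A = (e' ∘ e.symm) '' (e.target ∩ e.symm ⁻¹' A) := by
    ext z
    constructor
    · rintro ⟨hz, hzA⟩
      refine ⟨e (e'.symm z), ⟨e.map_source (h hzA), ?_⟩, ?_⟩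
      · simpa [e.left_inv (h hzA)] using hzA
      · simp [e.left_inv (h hzA), e'.right_inv hz]
    · rintro ⟨y, ⟨hy, hyA⟩, rfl⟩
      refine ⟨e'.map_source (h' hyA), ?_⟩
      simpa [e'.left_inv (h' hyA)] using hyA
  have hsub : e.target ∩ e.symm ⁻¹' A ⊆ e.target ∩ e.symm ⁻¹' e'.source :=
    fun y hy => ⟨hy.1, h' hy.2⟩
  rw [himage, lintegral_image_eq_lintegral_abs_det_fderiv_mul volume
    (measurableSet_target_inter_preimage e hA) (f' := fderiv ℝ (e' ∘ e.symm))]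
  · refine setLIntegral_congr_fun (measurableSet_target_inter_preimage e hA) fun y hy => ?_
    rw [chartCoeff_transition he he' μ hy.1 (h' hy.2), abs_mul, mul_comm |_|,
      ENNReal.ofReal_mul (abs_nonneg _)]
  · intro y hy
    exact ((contDiffAt_transition he he' hy.1 (h' hy.2)).differentiableAt
      (by simp)).hasFDerivAt.hasFDerivWithinAt
  · intro y hy z hz hyz
    have := e'.injOn (h' hy.2) (h' hz.2) hyz
    exact e.symm.injOn hy.1 hz.1 this

/-- A supremum of measures is not computed set by set, so an upper bound must come from one measure
dominating every chart measure: that of `e` on its domain, and the top measure outside, which does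
not charge `A`. -/
theorem volMeasure_restrict_le [IsManifold (𝓡 d) ∞ M]
    (he : e ∈ IsManifold.maximalAtlas (𝓡 d) ∞ M) (hA : MeasurableSet A) (h : A ⊆ e.source) :
    volMeasure μ A ≤ chartMeasure μ e A := by
  have hle : volMeasure μ ≤ chartMeasure μ e + (⊤ : Measure M).restrict e.sourceᶜ := by
    refine iSup_le fun x => ?_
    set c := chartAt (EuclideanSpace ℝ (Fin d)) x
    have hc : c ∈ IsManifold.maximalAtlas (𝓡 d) ∞ M := IsManifold.chart_mem_maximalAtlas x
    refine Measure.le_iff.2 fun B hB => ?_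
    have hs := e.open_source.measurableSet
    rw [← measure_inter_add_sdiff B hs, Measure.add_apply]
    refine add_le_add ?_ ?_
    · rw [← chartMeasure_inter_source (hB.inter hs), chartMeasure_eq_of_subset hc he
        ((hB.inter hs).inter c.open_source.measurableSet) (fun y hy => hy.2) (fun y hy => hy.1.2)]
      exact measure_mono fun y hy => hy.1.1
    · rw [Measure.restrict_apply hB]
      exact (le_top : chartMeasure μ c ≤ ⊤) _
  refine (hle A).trans (le_of_eq ?_)
  rw [Measure.add_apply, Measure.restrict_apply hA]
  have : A ∩ e.sourceᶜ = ∅ := by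
    ext y; simp; exact fun hy => h hy
  rw [this, measure_empty, add_zero]

/-- Countably many preferred charts cover `M`, so equality can be tested inside one of them. There
one inequality is `volMeasure_restrict_le`, and the other holds since the supremum dominates that
chart's measure, which agrees with that of `e` on the overlap. -/
theorem volMeasure_restrict_source [SigmaCompactSpace M] [IsManifold (𝓡 d) ∞ M]
    (he : e ∈ IsManifold.maximalAtlas (𝓡 d) ∞ M) :
    (volMeasure μ).restrict e.source = (chartMeasure μ e).restrict e.source := by
  have := ChartedSpace.secondCountable_of_sigmaCompact (EuclideanSpace ℝ (Fin d)) M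
  obtain ⟨s, hs, hcov⟩ := TopologicalSpace.countable_cover_nhds
    (fun x : M => (chartAt (EuclideanSpace ℝ (Fin d)) x).open_source.mem_nhds
      (mem_chart_source _ x))
  have key := (Measure.restrict_biUnion_congr (μ := (volMeasure μ).restrict e.source)
    (ν := (chartMeasure μ e).restrict e.source)
    (t := fun x : M => (chartAt (EuclideanSpace ℝ (Fin d)) x).source) hs).2 ?_
  · rwa [hcov, Measure.restrict_univ, Measure.restrict_univ] at key
  · intro x _
    set c := chartAt (EuclideanSpace ℝ (Fin d)) x
    have hc : c ∈ IsManifold.maximalAtlas (𝓡 d) ∞ M := IsManifold.chart_mem_maximalAtlas x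
    refine Measure.ext fun B hB => ?_
    have hcs := c.open_source.measurableSet
    have hes := e.open_source.measurableSet
    rw [Measure.restrict_apply hB, Measure.restrict_apply (hB.inter hcs),
      Measure.restrict_apply hB, Measure.restrict_apply (hB.inter hcs)]
    have hm := (hB.inter hcs).inter hes
    refine le_antisymm (volMeasure_restrict_le he hm fun y hy => hy.2) ?_
    rw [chartMeasure_eq_of_subset he hc hm (fun y hy => hy.2) (fun y hy => hy.1.2)]
    exact le_iSup (fun x : M => chartMeasure μ (chartAt (EuclideanSpace ℝ (Fin d)) x)) x _

theorem volMeasure_restrict_eq_map [SigmaCompactSpace M] [IsManifold (𝓡 d) ∞ M]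
    (he : e ∈ IsManifold.maximalAtlas (𝓡 d) ∞ M) (hA : MeasurableSet A) (h : A ⊆ e.source) :
    (volMeasure μ).restrict A = Measure.map e.symm
      ((volume.restrict (e.target ∩ e.symm ⁻¹' A)).withDensity
        (fun y => ENNReal.ofReal |chartCoeff μ e y|)) := by
  have h1 : (volMeasure μ).restrict A = ((volMeasure μ).restrict e.source).restrict A := by
    rw [Measure.restrict_restrict hA, inter_eq_left.2 h]
  rw [h1, volMeasure_restrict_source he, Measure.restrict_restrict hA, inter_eq_left.2 h,
    chartMeasure, Measure.restrict_map_of_aemeasurable aemeasurable_symm_density hA,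
    restrict_withDensity', Measure.restrict_restrict' e.open_target.measurableSet, inter_comm]

/-- Integrals over a subset of the domain of a chart are computed in coordinates. -/
theorem setIntegral_volMeasure [SigmaCompactSpace M] [IsManifold (𝓡 d) ∞ M]
    [RiemannianBundle (fun x : M => TangentSpace (𝓡 d) x)] (hμ : IsRiemannianVolumeForm μ)
    (he : e ∈ IsManifold.maximalAtlas (𝓡 d) ∞ M) (hA : MeasurableSet A) (h : A ⊆ e.source)
    {g : M → ℝ} (hg : AEStronglyMeasurable g ((volMeasure μ).restrict A)) :
    (IntegrableOn g A (volMeasure μ) ↔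
      IntegrableOn (fun y => |chartCoeff μ e y| * g (e.symm y)) (e.target ∩ e.symm ⁻¹' A)) ∧
    ∫ x in A, g x ∂(volMeasure μ) =
      ∫ y in e.target ∩ e.symm ⁻¹' A, |chartCoeff μ e y| * g (e.symm y) := by
  have hρ : AEMeasurable (fun y => ENNReal.ofReal |chartCoeff μ e y|)
      (volume.restrict (e.target ∩ e.symm ⁻¹' A)) := by
    have : ContinuousOn (fun y => |chartCoeff μ e y|) (e.target ∩ e.symm ⁻¹' A) :=
      ((hμ.smooth e he).continuousOn.mono inter_subset_left).abs
    exact (this.aemeasurable (measurableSet_target_inter_preimage e hA)).ennreal_ofReal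
  have hfin : ∀ᵐ y ∂(volume.restrict (e.target ∩ e.symm ⁻¹' A)),
      ENNReal.ofReal |chartCoeff μ e y| < ⊤ := Filter.Eventually.of_forall fun _ => by simp
  have hsymm : AEMeasurable e.symm ((volume.restrict (e.target ∩ e.symm ⁻¹' A)).withDensity
      (fun y => ENNReal.ofReal |chartCoeff μ e y|)) :=
    ((e.continuousOn_symm.mono inter_subset_left).aemeasurable
      (measurableSet_target_inter_preimage e hA)).mono_ac (withDensity_absolutelyContinuous _ _)
  have hmap := volMeasure_restrict_eq_map (μ := μ) he hA h
  rw [IntegrableOn, IntegrableOn, hmap]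
  rw [hmap] at hg
  rw [integrable_map_measure hg hsymm, integral_map hsymm hg,
    integrable_withDensity_iff_integrable_smul₀' hρ hfin,
    integral_withDensity_eq_integral_toReal_smul₀ hρ hfin]
  simp only [ENNReal.toReal_ofReal (abs_nonneg _), smul_eq_mul, Function.comp_apply, and_self]

end VolumeMeasure

/-! ### The divergence theorem on a half-space -/

section HalfSpace

open DividingHypersurface.AdaptedPartition (slice)

variable {n : ℕ}

/-- The closed half-space `σ x₀ ≤ 0`. -/
def halfSpace (n : ℕ) (σ : ℝ) : Set (EuclideanSpace ℝ (Fin (n + 1))) := {y | σ * y 0 ≤ 0}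

/-- The open half-space `σ x₀ < 0`. -/
def openHalfSpace (n : ℕ) (σ : ℝ) : Set (EuclideanSpace ℝ (Fin (n + 1))) := {y | σ * y 0 < 0}

variable {σ : ℝ}

theorem continuous_mul_coord : Continuous (fun y : EuclideanSpace ℝ (Fin (n + 1)) => σ * y 0) := by
  fun_prop

theorem isOpen_openHalfSpace : IsOpen (openHalfSpace n σ) :=
  isOpen_lt continuous_mul_coord continuous_const

theorem isClosed_halfSpace : IsClosed (halfSpace n σ) :=
  isClosed_le continuous_mul_coord continuous_const

theorem openHalfSpace_subset : openHalfSpace n σ ⊆ halfSpace n σ := fun _ hy => le_of_lt (α := ℝ) hy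

/-- A convex set with nonempty interior. This makes `fderivWithin` continuous up to the boundary
hyperplane. -/
theorem uniqueDiffOn_halfSpace (hσ : σ ≠ 0) : UniqueDiffOn ℝ (halfSpace n σ) := by
  refine uniqueDiffOn_convex ?_ ⟨EuclideanSpace.single 0 (-σ), ?_⟩
  · intro x hx y hy a b ha hb hab
    simp only [halfSpace, mem_ofPred_eq, PiLp.add_apply, PiLp.smul_apply, smul_eq_mul] at *
    nlinarith [mul_nonneg ha (neg_nonneg.2 hx), mul_nonneg hb (neg_nonneg.2 hy)]
  · refine mem_interior.2 ⟨_, openHalfSpace_subset, isOpen_openHalfSpace, ?_⟩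
    simp only [openHalfSpace, mem_ofPred_eq, PiLp.single_apply, if_true]
    nlinarith [mul_self_pos.2 hσ]

variable {g : Fin (n + 1) → EuclideanSpace ℝ (Fin (n + 1)) → ℝ}
  {K : Set (EuclideanSpace ℝ (Fin (n + 1)))}

theorem fderiv_eq_zero_of_notMem (hK : IsCompact K) (h0 : ∀ i, ∀ y ∉ K, g i y = 0)
    {y : EuclideanSpace ℝ (Fin (n + 1))} (hy : y ∉ K) (i : Fin (n + 1)) : fderiv ℝ (g i) y = 0 := by
  have : g i =ᶠ[𝓝 y] fun _ => 0 := by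
    filter_upwards [hK.isClosed.isOpen_compl.mem_nhds hy] with z hz
    exact h0 i z hz
  rw [this.fderiv_eq, fderiv_fun_const]
  rfl

/-- In the open half-space the derivatives coincide with those within the closed one, which are
continuous up to the boundary and hence integrable on the compact part in `K`; outside `K` they
vanish. -/
theorem integrableOn_coord_divergence (hσ : σ ≠ 0) (hK : IsCompact K)
    (hg : ∀ i, ContDiffOn ℝ 1 (g i) (halfSpace n σ)) (h0 : ∀ i, ∀ y ∉ K, g i y = 0) :
    IntegrableOn (fun y => ∑ i, fderiv ℝ (g i) y (EuclideanSpace.single i 1))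
      (openHalfSpace n σ) := by
  have hc : ContinuousOn
      (fun y => ∑ i, fderivWithin ℝ (g i) (halfSpace n σ) y (EuclideanSpace.single i 1))
      (halfSpace n σ) := by
    refine continuousOn_finsetSum _ fun i _ => ?_
    exact ((hg i).continuousOn_fderivWithin (uniqueDiffOn_halfSpace hσ) le_rfl).clm_apply
      continuousOn_const
  have h1 : IntegrableOn (fun y => ∑ i, fderiv ℝ (g i) y (EuclideanSpace.single i 1))
      (openHalfSpace n σ ∩ K) := by
    refine ((hc.mono inter_subset_left).integrableOn_compact
      (hK.inter_left isClosed_halfSpace)).mono_set (inter_subset_inter_left K openHalfSpace_subset)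
      |>.congr_fun (fun y hy => ?_) (isOpen_openHalfSpace.measurableSet.inter hK.measurableSet)
    refine Finset.sum_congr rfl fun i _ => ?_
    rw [fderivWithin_of_mem_nhds (Filter.mem_of_superset (isOpen_openHalfSpace.mem_nhds hy.1)
      openHalfSpace_subset)]
  refine h1.of_forall_sdiff_eq_zero isOpen_openHalfSpace.measurableSet fun y hy => ?_
  refine Finset.sum_eq_zero fun i _ => ?_
  rw [fderiv_eq_zero_of_notMem hK h0 (fun h => hy.2 ⟨hy.1, h⟩)]
  rfl

/-- The divergence theorem on a box with sides `lo ≤ x₀ ≤ hi` and `|xᵢ| ≤ R`, for a field that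
vanishes where `|xᵢ| = R`. -/
theorem integral_box_divergence (hσ : σ ≠ 0) (hK : IsCompact K)
    (hg : ∀ i, ContDiffOn ℝ 1 (g i) (halfSpace n σ)) (h0 : ∀ i, ∀ y ∉ K, g i y = 0)
    {R lo hi : ℝ} (hR : 0 < R) (hKR : ∀ y ∈ K, ∀ i, |y i| < R) (hlohi : lo ≤ hi)
    (hclosed : ∀ y : EuclideanSpace ℝ (Fin (n + 1)), lo ≤ y 0 → y 0 ≤ hi → σ * y 0 ≤ 0)
    (hopen : ∀ y : EuclideanSpace ℝ (Fin (n + 1)), lo < y 0 → y 0 < hi → σ * y 0 < 0)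
    (hbox : ∀ y ∈ K, σ * y 0 < 0 → lo < y 0 ∧ y 0 < hi) :
    ∫ y in openHalfSpace n σ, ∑ i, fderiv ℝ (g i) y (EuclideanSpace.single i 1) =
      (∫ z : Fin n → ℝ, g 0 (WithLp.toLp 2 (Fin.cons hi z))) -
        ∫ z : Fin n → ℝ, g 0 (WithLp.toLp 2 (Fin.cons lo z)) := by
  set D : EuclideanSpace ℝ (Fin (n + 1)) → ℝ :=
    fun y => ∑ i, fderiv ℝ (g i) y (EuclideanSpace.single i 1) with hD
  let T : (Fin (n + 1) → ℝ) ≃L[ℝ] EuclideanSpace ℝ (Fin (n + 1)) :=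
    (PiLp.continuousLinearEquiv 2 ℝ (fun _ => ℝ)).symm
  let a : Fin (n + 1) → ℝ := Fin.cons lo (fun _ => -R)
  let b : Fin (n + 1) → ℝ := Fin.cons hi (fun _ => R)
  have hab : a ≤ b := by
    intro i
    refine Fin.cases ?_ (fun j => ?_) i
    · simpa [a, b] using hlohi
    · simp [a, b]; linarith
  have hD0 : ∀ y ∉ K, D y = 0 := fun y hy => by
    refine Finset.sum_eq_zero fun i _ => ?_
    rw [fderiv_eq_zero_of_notMem hK h0 hy]
    rfl
  have hmp : MeasurePreserving T volume volume := PiLp.volume_preserving_toLp (Fin (n + 1))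
  have hemb : MeasurableEmbedding T := T.toHomeomorph.measurableEmbedding
  have hIoo : ∀ x ∈ (pi univ fun i => Ioo (a i) (b i)), T x ∈ openHalfSpace n σ := by
    intro x hx
    have := hx 0 (mem_univ _)
    exact hopen (T x) this.1 this.2
  have hHs : MeasurableSet (T ⁻¹' openHalfSpace n σ) :=
    isOpen_openHalfSpace.measurableSet.preimage T.continuous.measurable
  have hint : IntegrableOn (fun x => D (T x)) (T ⁻¹' openHalfSpace n σ) :=
    (hmp.integrableOn_comp_preimage hemb (f := D)).2 (integrableOn_coord_divergence hσ hK hg h0)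
  have hae : (pi univ fun i => Ioo (a i) (b i)) =ᵐ[volume] Icc a b :=
    Measure.univ_pi_Ioo_ae_eq_Icc
  -- By `hbox` and `hKR` the part of `K` in the open half-space lies in the open box, so nothing is
  -- lost outside it; the closed box differs by a null set.
  have h1 : ∫ y in openHalfSpace n σ, D y = ∫ x in Icc a b, D (T x) := by
    rw [← hmp.setIntegral_preimage_emb hemb, ← setIntegral_congr_set hae]
    refine setIntegral_eq_of_subset_of_forall_sdiff_eq_zero hHs hIoo fun x hx => ?_
    by_contra hne
    have hxK : T x ∈ K := by
      by_contra h; exact hne (hD0 _ h)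
    refine hx.2 fun i _ => ?_
    refine Fin.cases ?_ (fun j => ?_) i
    · exact hbox _ hxK hx.1
    · exact abs_lt.1 (hKR _ hxK j.succ)
  have hDsum : ∀ x, D (T x) = ∑ i, ((fderiv ℝ (g i) (T x)).comp T.toContinuousLinearMap)
      (Pi.single i 1) := by
    intro x
    refine Finset.sum_congr rfl fun i _ => ?_
    rfl
  -- Derivatives are required only in the interior of the box. This matters because a face may lie
  -- on `x₀ = 0`, where only one-sided smoothness is known.
  have h2 := integral_divergence_of_hasFDerivAt_off_countable' a b hab
    (fun i x => g i (T x)) (fun i x => (fderiv ℝ (g i) (T x)).comp T.toContinuousLinearMap) ∅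
    countable_empty ?_ ?_ ?_
  rotate_left
  · intro i
    refine (hg i).continuousOn.comp T.continuous.continuousOn fun x hx => ?_
    exact hclosed (T x) (hx.1 0) (hx.2 0)
  · intro x hx i
    have hx' := hIoo x hx.1
    have hd : DifferentiableAt ℝ (g i) (T x) :=
      ((hg i).contDiffAt (Filter.mem_of_superset (isOpen_openHalfSpace.mem_nhds hx')
        openHalfSpace_subset)).differentiableAt one_ne_zero
    exact hd.hasFDerivAt.comp x T.toContinuousLinearMap.hasFDerivAt
  · simp_rw [← hDsum]
    exact (hint.mono_set hIoo).congr_set_ae hae.symm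
  simp_rw [← hDsum] at h2
  rw [h1, h2, Fin.sum_univ_succ, Finset.sum_eq_zero, add_zero]
  -- The field vanishes when some other coordinate leaves `[-R, R]`, so integrals over the two faces
  -- `x₀ = const` extend to the whole hyperplane.
  · have hface : ∀ t : ℝ, ∫ z in Icc (a ∘ (0 : Fin (n + 1)).succAbove)
        (b ∘ (0 : Fin (n + 1)).succAbove), g 0 (T (Fin.insertNth 0 t z)) =
        ∫ z : Fin n → ℝ, g 0 (WithLp.toLp 2 (Fin.cons t z)) := by
      intro t
      refine (setIntegral_eq_integral_of_forall_compl_eq_zero fun z hz => ?_).trans ?_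
      · by_contra hne
        have hzK : T (Fin.insertNth 0 t z) ∈ K := by
          by_contra h; exact hne (h0 0 _ h)
        refine hz ⟨fun j => ?_, fun j => ?_⟩
        · have := (abs_lt.1 (hKR _ hzK j.succ)).1.le
          rw [Fin.insertNth_zero'] at this
          simpa [a, T] using this
        · have := (abs_lt.1 (hKR _ hzK j.succ)).2.le
          rw [Fin.insertNth_zero'] at this
          simpa [b, T] using this
      · simp_rw [Fin.insertNth_zero']
        rfl
    exact congrArg₂ (· - ·) (hface (b 0)) (hface (a 0))
  · intro j _
    -- The lateral faces miss `K`, since the bound by `R` is strict.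
    have hz : ∀ t : ℝ, |t| = R → ∀ z : Fin n → ℝ, g j.succ (T (Fin.insertNth j.succ t z)) = 0 := by
      intro t ht z
      refine h0 _ _ fun hK' => ?_
      have := hKR _ hK' j.succ
      have h3 : T (Fin.insertNth j.succ t z) j.succ = t :=
        Fin.insertNth_apply_same (α := fun _ => ℝ) j.succ t z
      rw [h3, ht] at this
      exact lt_irrefl _ this
    have hbR : |b j.succ| = R := by simp [b, abs_of_pos hR]
    have haR : |a j.succ| = R := by simp [a, abs_of_pos hR]
    simp only [hz _ hbR, hz _ haR, integral_zero, sub_zero]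

theorem integral_cons_eq_slice (f : EuclideanSpace ℝ (Fin (n + 1)) → ℝ) :
    ∫ z : Fin n → ℝ, f (WithLp.toLp 2 (Fin.cons 0 z)) =
      ∫ y : EuclideanSpace ℝ (Fin n), f (slice y) :=
  ((PiLp.volume_preserving_toLp (Fin n)).integral_comp
    (MeasurableEquiv.toLp 2 (Fin n → ℝ)).measurableEmbedding (fun y => f (slice y)))

/-- The divergence theorem on a half-space, for a compactly supported field. -/
theorem integral_halfSpace_divergence (hσ : σ = 1 ∨ σ = -1) (hK : IsCompact K)
    (hg : ∀ i, ContDiffOn ℝ 1 (g i) (halfSpace n σ)) (h0 : ∀ i, ∀ y ∉ K, g i y = 0) :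
    ∫ y in openHalfSpace n σ, ∑ i, fderiv ℝ (g i) y (EuclideanSpace.single i 1) =
      σ * ∫ y : EuclideanSpace ℝ (Fin n), g 0 (slice y) := by
  obtain ⟨R, hR, hKR⟩ : ∃ R : ℝ, 0 < R ∧ ∀ y ∈ K, ∀ i, |y i| < R := by
    obtain ⟨R, hR⟩ := hK.isBounded.exists_norm_le
    refine ⟨max R 0 + 1, by positivity, fun y hy i => ?_⟩
    have h1 := PiLp.norm_apply_le y i
    rw [Real.norm_eq_abs] at h1
    have h2 := hR y hy
    have h3 := le_max_left R 0
    linarith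
  have hz : ∀ t : ℝ, |t| = R → ∫ z : Fin n → ℝ, g 0 (WithLp.toLp 2 (Fin.cons t z)) = 0 := by
    intro t ht
    refine (integral_congr_ae (Filter.Eventually.of_forall fun z => ?_)).trans (integral_zero _ _)
    refine h0 0 _ fun h => ?_
    have := hKR _ h 0
    simp only [Fin.cons_zero, ht] at this
    exact lt_irrefl _ this
  rcases hσ with rfl | rfl
  -- For `σ = 1` the hyperplane `x₀ = 0` is the upper face of `[-R, 0]`, for `σ = -1` the lower face
  -- of `[0, R]`; hence the sign. The opposite face misses `K`.
  · rw [integral_box_divergence one_ne_zero hK hg h0 hR hKR (lo := -R) (hi := 0), hz (-R),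
      integral_cons_eq_slice, sub_zero, one_mul]
    · simp [abs_of_pos hR]
    · linarith
    · intro y _ h; linarith
    · intro y _ h; linarith
    · intro y hy h
      exact ⟨(abs_lt.1 (hKR y hy 0)).1, by linarith⟩
  · rw [integral_box_divergence (by norm_num) hK hg h0 hR hKR (lo := 0) (hi := R), hz R,
      integral_cons_eq_slice, zero_sub, neg_one_mul]
    · simp [abs_of_pos hR]
    · linarith
    · intro y h _; linarith
    · intro y h _; linarith
    · intro y hy h
      exact ⟨by linarith, (abs_lt.1 (hKR y hy 0)).2⟩

end HalfSpace

/-! ### The divergence theorem inside one chart -/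

section LocalStokes

open DividingHypersurface.AdaptedPartition (slice)

theorem continuous_slice {n : ℕ} :
    Continuous (slice : EuclideanSpace ℝ (Fin n) → EuclideanSpace ℝ (Fin (n + 1))) := by
  refine (PiLp.continuous_toLp 2 _).comp (continuous_pi fun i => ?_)
  refine Fin.cases ?_ (fun j => ?_) i
  · simpa using continuous_const
  · simp only [Fin.cons_succ]; fun_prop

theorem isCompact_preimage_slice {n : ℕ} {L : Set (EuclideanSpace ℝ (Fin (n + 1)))}
    (hL : IsCompact L) :
    IsCompact ((slice : EuclideanSpace ℝ (Fin n) → EuclideanSpace ℝ (Fin (n + 1))) ⁻¹' L) := by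
  let proj : EuclideanSpace ℝ (Fin (n + 1)) → EuclideanSpace ℝ (Fin n) :=
    fun y => WithLp.toLp 2 (fun i => y i.succ)
  have hproj : Continuous proj :=
    (PiLp.continuous_toLp 2 _).comp (continuous_pi fun i => by fun_prop)
  refine (hL.image hproj).of_isClosed_subset (hL.isClosed.preimage continuous_slice) fun y hy => ?_
  exact ⟨slice y, hy, by ext i; simp [proj, slice]⟩

theorem isCompact_image_chart {X Y : Type*} [TopologicalSpace X] [TopologicalSpace Y]
    {e : OpenPartialHomeomorph X Y} {K : Set X} (hK : IsCompact K) (hKe : K ⊆ e.source) :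
    IsCompact (e '' K) :=
  hK.image_of_continuousOn (e.continuousOn.mono hKe)

theorem slice_mem_halfSpace {n : ℕ} (σ : ℝ) (y : EuclideanSpace ℝ (Fin n)) :
    slice y ∈ halfSpace n σ := by
  change σ * (0 : ℝ) ≤ 0
  simp

variable {n : ℕ} {M : Type u} [TopologicalSpace M] [ChartedSpace (EuclideanSpace ℝ (Fin (n + 1))) M]
  {e : OpenPartialHomeomorph M (EuclideanSpace ℝ (Fin (n + 1)))}
  {μ : FormField (n + 1) (n + 1) M} {U S K : Set M} {σ : ℝ}
  {w : (x : M) → TangentSpace (𝓡 (n + 1)) x}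

/-- A chart in which the open region `U` and its closure `S` are the half-spaces `σ x₀ < 0` and
`σ x₀ ≤ 0`. -/
structure IsHalfChart (U S : Set M) (σ : ℝ)
    (e : OpenPartialHomeomorph M (EuclideanSpace ℝ (Fin (n + 1)))) : Prop where
  mem_maximalAtlas : e ∈ IsManifold.maximalAtlas (𝓡 (n + 1)) ∞ M
  mem_interior_iff : ∀ q ∈ e.source, (q ∈ U ↔ e q ∈ openHalfSpace n σ)
  mem_iff : ∀ q ∈ e.source, (q ∈ S ↔ e q ∈ halfSpace n σ)

theorem IsHalfChart.symm_mem_interior_iff (he : IsHalfChart U S σ e)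
    {y : EuclideanSpace ℝ (Fin (n + 1))} (hy : y ∈ e.target) :
    e.symm y ∈ U ↔ y ∈ openHalfSpace n σ := by
  rw [he.mem_interior_iff _ (e.map_target hy), e.right_inv hy]

theorem IsHalfChart.symm_mem_iff (he : IsHalfChart U S σ e)
    {y : EuclideanSpace ℝ (Fin (n + 1))} (hy : y ∈ e.target) :
    e.symm y ∈ S ↔ y ∈ halfSpace n σ := by
  rw [he.mem_iff _ (e.map_target hy), e.right_inv hy]

/-- The components `|ρ| wᵢ` of the vector density of `w` in the chart `e`, extended by zero. -/
def chartFlux (μ : FormField (n + 1) (n + 1) M)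
    (e : OpenPartialHomeomorph M (EuclideanSpace ℝ (Fin (n + 1))))
    (w : (x : M) → TangentSpace (𝓡 (n + 1)) x) (i : Fin (n + 1))
    (y : EuclideanSpace ℝ (Fin (n + 1))) : ℝ :=
  e.target.indicator (fun y => |chartCoeff μ e y| * chartVec e w y i) y

theorem chartVec_eq_zero {y : EuclideanSpace ℝ (Fin (n + 1))} (h : w (e.symm y) = 0) :
    chartVec e w y = 0 := by
  rw [chartVec, h, map_zero]
  rfl

theorem chartFlux_eq_zero (hw : ∀ x ∉ K, w x = 0) (i : Fin (n + 1))
    (y : EuclideanSpace ℝ (Fin (n + 1))) (hy : y ∉ e '' K) : chartFlux μ e w i y = 0 := by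
  by_cases hyt : y ∈ e.target
  · rw [chartFlux, indicator_of_mem hyt,
      chartVec_eq_zero (hw _ fun h => hy ⟨_, h, e.right_inv hyt⟩)]
    simp
  · exact indicator_of_notMem hyt _

variable [IsManifold (𝓡 (n + 1)) ∞ M]
  [RiemannianBundle (fun x : M => TangentSpace (𝓡 (n + 1)) x)]

/-- Inside the target, `|ρ|` is smooth because `ρ` has no zeros. A point outside the target has a
neighbourhood missing the closed set `e '' K`, and there the extension by zero vanishes. -/
theorem contDiffOn_chartFlux [T2Space M] (hμ : IsRiemannianVolumeForm μ)
    (he : IsHalfChart U S σ e) (hws : SmoothFieldOn w S) (hK : IsCompact K) (hKe : K ⊆ e.source)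
    (hw : ∀ x ∉ K, w x = 0) (i : Fin (n + 1)) :
    ContDiffOn ℝ 1 (chartFlux μ e w i) (halfSpace n σ) := by
  have hmain : ContDiffOn ℝ 1 (fun y => |chartCoeff μ e y| * chartVec e w y i)
      (e.target ∩ e.symm ⁻¹' S) := by
    have h1 : ContDiffOn ℝ 1 (fun y => |chartCoeff μ e y|) e.target :=
      ((hμ.smooth e he.mem_maximalAtlas).of_le (WithTop.coe_le_coe.2 le_top)).abs
        fun y hy => hμ.chartCoeff_ne_zero he.mem_maximalAtlas hy
    have h2 : ContDiffOn ℝ 1 (chartVec e w) (e.target ∩ e.symm ⁻¹' S) :=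
      (hws.contDiffOn_chartVec he.mem_maximalAtlas).of_le (WithTop.coe_le_coe.2 le_top)
    exact (h1.mono inter_subset_left).mul (contDiffOn_piLp 2 |>.1 h2 i)
  intro y hy
  by_cases hyt : y ∈ e.target
  · have h1 : ContDiffWithinAt ℝ 1 (chartFlux μ e w i) (e.target ∩ e.symm ⁻¹' S) y :=
      (hmain y ⟨hyt, (he.symm_mem_iff hyt).2 hy⟩).congr
        (fun z hz => indicator_of_mem hz.1 _) (indicator_of_mem hyt _)
    refine h1.mono_of_mem_nhdsWithin ?_
    filter_upwards [mem_nhdsWithin_of_mem_nhds (e.open_target.mem_nhds hyt), self_mem_nhdsWithin]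
      with z hz hz'
    exact ⟨hz, (he.symm_mem_iff hz).2 hz'⟩
  · have hL := (isCompact_image_chart hK hKe).isClosed
    have hyL : y ∉ e '' K := fun ⟨x, hx, hxy⟩ => hyt (hxy ▸ e.map_source (hKe hx))
    have : chartFlux μ e w i =ᶠ[𝓝 y] fun _ => 0 := by
      filter_upwards [hL.isOpen_compl.mem_nhds hyL] with z hz
      exact chartFlux_eq_zero hw i z hz
    exact (contDiffAt_const.congr_of_eventuallyEq this).contDiffWithinAt

/-- The sign `s` of `ρ` is locally constant, so `|ρ| = s ρ` near `y` and the factor passes through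
the derivatives. -/
theorem abs_mul_divergence (hμ : IsRiemannianVolumeForm μ)
    (he : e ∈ IsManifold.maximalAtlas (𝓡 (n + 1)) ∞ M) (hU : IsOpen U) (hws : SmoothFieldOn w U)
    {y : EuclideanSpace ℝ (Fin (n + 1))} (hy : y ∈ e.target) (hyU : e.symm y ∈ U) :
    |chartCoeff μ e y| * divergence μ w (e.symm y) =
      ∑ i, fderiv ℝ (chartFlux μ e w i) y (EuclideanSpace.single i 1) := by
  rw [divergence_eq_coordDivergence hμ hws (hU.mem_nhds hyU) he (e.map_target hy), e.right_inv hy]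
  have hne := hμ.chartCoeff_ne_zero he hy
  obtain ⟨s, hs⟩ : ∃ s : ℝ, ∀ᶠ z in 𝓝 y, |chartCoeff μ e z| = s * chartCoeff μ e z := by
    have hc := (hμ.differentiableAt_chartCoeff he hy).continuousAt
    rcases lt_or_gt_of_ne hne with h | h
    · refine ⟨-1, ?_⟩
      filter_upwards [hc.eventually (gt_mem_nhds h)] with z hz
      rw [abs_of_neg hz]; ring
    · refine ⟨1, ?_⟩
      filter_upwards [hc.eventually (lt_mem_nhds h)] with z hz
      rw [abs_of_pos hz, one_mul]
  have h1 : ∀ i, fderiv ℝ (chartFlux μ e w i) y =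
      s • fderiv ℝ (fun z => chartCoeff μ e z * chartVec e w z i) y := by
    intro i
    have hd : DifferentiableAt ℝ (fun z => chartCoeff μ e z * chartVec e w z i) y := by
      have := hws.differentiableAt_chartVec (hU.mem_nhds hyU) he (e.map_target hy)
      rw [e.right_inv hy] at this
      exact (hμ.differentiableAt_chartCoeff he hy).mul (differentiableAt_piLp 2 |>.1 this i)
    rw [← fderiv_const_mul hd]
    refine Filter.EventuallyEq.fderiv_eq ?_
    filter_upwards [hs, e.open_target.mem_nhds hy] with z hz hzt
    rw [chartFlux, indicator_of_mem hzt, hz, mul_assoc]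
  simp_rw [h1, coordDivergence, hs.self_of_nhds]
  simp only [smul_apply, smul_eq_mul, ← Finset.mul_sum]
  field_simp

/-- Near `x` the divergence is given by the coordinate formula in the single chart at `x`, which is
continuous. -/
theorem continuousOn_divergence (hμ : IsRiemannianVolumeForm μ) (hU : IsOpen U)
    (hws : SmoothFieldOn w U) : ContinuousOn (divergence μ w) U := by
  intro x hx
  set c := chartAt (EuclideanSpace ℝ (Fin (n + 1))) x
  have hc : c ∈ IsManifold.maximalAtlas (𝓡 (n + 1)) ∞ M := IsManifold.chart_mem_maximalAtlas x
  have hxc : x ∈ c.source := mem_chart_source _ x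
  have hV : IsOpen (c.target ∩ c.symm ⁻¹' U) := c.symm.isOpen_inter_preimage hU
  have hcont : ContinuousOn (coordDivergence (chartCoeff μ c) (chartVec c w))
      (c.target ∩ c.symm ⁻¹' U) := by
    have hρ := (hμ.smooth c hc).mono (inter_subset_left (t := c.symm ⁻¹' U))
    refine (hρ.continuousOn.inv₀ fun y hy => hμ.chartCoeff_ne_zero hc hy.1).mul ?_
    refine continuousOn_finsetSum _ fun i _ => ?_
    have h2 := (contDiffOn_piLp 2).1 (hws.contDiffOn_chartVec hc) i
    exact ((hρ.mul h2).continuousOn_fderiv_of_isOpen hV (by simp)).clm_apply continuousOn_const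
  have h1 : ContinuousAt (fun z => coordDivergence (chartCoeff μ c) (chartVec c w) (c z)) x :=
    (hcont.continuousAt (hV.mem_nhds ⟨c.map_source hxc, by simpa [c.left_inv hxc] using hx⟩)).comp
      (c.continuousAt hxc)
  refine (h1.congr ?_).continuousWithinAt
  filter_upwards [c.open_source.mem_nhds hxc, hU.mem_nhds hx] with z hz hzU
  exact (divergence_eq_coordDivergence hμ hws (hU.mem_nhds hzU) hc hz).symm

theorem integrable_chartFlux_slice [T2Space M] (hμ : IsRiemannianVolumeForm μ)
    (he : IsHalfChart U S σ e) (hws : SmoothFieldOn w S) (hK : IsCompact K) (hKe : K ⊆ e.source)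
    (hw : ∀ x ∉ K, w x = 0) :
    Integrable (fun y : EuclideanSpace ℝ (Fin n) => chartFlux μ e w 0 (slice y)) := by
  have hc : Continuous (fun y : EuclideanSpace ℝ (Fin n) => chartFlux μ e w 0 (slice y)) :=
    (contDiffOn_chartFlux hμ he hws hK hKe hw 0).continuousOn.comp_continuous continuous_slice
      (slice_mem_halfSpace σ)
  refine hc.integrable_of_hasCompactSupport (HasCompactSupport.intro
    (isCompact_preimage_slice (isCompact_image_chart hK hKe)) fun y hy => ?_)
  exact chartFlux_eq_zero hw 0 _ hy

/-- The divergence theorem for a field with compact support in the domain of a half-chart. -/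
theorem integral_divergence_of_support_subset [T2Space M] [SigmaCompactSpace M] [MeasurableSpace M]
    [BorelSpace M] (hμ : IsRiemannianVolumeForm μ) (hσ : σ = 1 ∨ σ = -1)
    (he : IsHalfChart U S σ e) (hU : IsOpen U) (hUS : U ⊆ S) (hws : SmoothFieldOn w S)
    (hK : IsCompact K) (hKe : K ⊆ e.source) (hw : ∀ x ∉ K, w x = 0) :
    IntegrableOn (divergence μ w) U (volMeasure μ) ∧
      ∫ x in U, divergence μ w x ∂(volMeasure μ) =
        σ * ∫ y : EuclideanSpace ℝ (Fin n), chartFlux μ e w 0 (slice y) := by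
  have hσ0 : σ ≠ 0 := by rcases hσ with rfl | rfl <;> norm_num
  have hwU : SmoothFieldOn w U := hws.mono hUS
  have hL := isCompact_image_chart hK hKe
  have hg := fun i => contDiffOn_chartFlux hμ he hws hK hKe hw i
  have h0 := fun i => chartFlux_eq_zero (μ := μ) (e := e) hw i
  have hmU : MeasurableSet U := hU.measurableSet
  have hmA : MeasurableSet (U ∩ e.source) := hmU.inter e.open_source.measurableSet
  have hdiv0 : ∀ x ∈ U \ (U ∩ e.source), divergence μ w x = 0 := by
    intro x hx
    refine divergence_eq_zero_of_eventually ?_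
    filter_upwards [hK.isClosed.isOpen_compl.mem_nhds fun h => hx.2 ⟨hx.1, hKe h⟩] with z hz
    exact hw z hz
  have hmeas : AEStronglyMeasurable (divergence μ w) ((volMeasure μ).restrict (U ∩ e.source)) := by
    have := ChartedSpace.secondCountable_of_sigmaCompact (EuclideanSpace ℝ (Fin (n + 1))) M
    exact ((continuousOn_divergence hμ hU hwU).mono inter_subset_left).aestronglyMeasurable hmA
  obtain ⟨h1, h2⟩ := setIntegral_volMeasure hμ he.mem_maximalAtlas hmA inter_subset_right hmeas
  have hset : e.target ∩ e.symm ⁻¹' (U ∩ e.source) = e.target ∩ openHalfSpace n σ := by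
    ext y
    refine and_congr_right fun hy => ?_
    rw [← he.symm_mem_interior_iff hy]
    exact and_iff_left (e.map_target hy)
  rw [hset] at h1 h2
  have hmT : MeasurableSet (e.target ∩ openHalfSpace n σ) :=
    e.open_target.measurableSet.inter isOpen_openHalfSpace.measurableSet
  have hcongr : EqOn (fun y => |chartCoeff μ e y| * divergence μ w (e.symm y))
      (fun y => ∑ i, fderiv ℝ (chartFlux μ e w i) y (EuclideanSpace.single i 1))
      (e.target ∩ openHalfSpace n σ) := fun y hy =>
    abs_mul_divergence hμ he.mem_maximalAtlas hU hwU hy.1 ((he.symm_mem_interior_iff hy.1).2 hy.2)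
  refine ⟨(h1.2 ?_).of_forall_sdiff_eq_zero hmU hdiv0, ?_⟩
  · exact ((integrableOn_coord_divergence hσ0 hL hg h0).mono_set inter_subset_right).congr_fun
      hcongr.symm hmT
  · rw [setIntegral_eq_of_subset_of_forall_sdiff_eq_zero hmU inter_subset_left hdiv0, h2,
      setIntegral_congr_fun hmT hcongr, ← integral_halfSpace_divergence hσ hL hg h0]
    -- Outside the target the flux vanishes near every point, so the integral over the target
    -- extends to the whole half-space.
    refine (setIntegral_eq_of_subset_of_forall_sdiff_eq_zero isOpen_openHalfSpace.measurableSet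
      inter_subset_right fun y hy => Finset.sum_eq_zero fun i _ => ?_).symm
    rw [fderiv_eq_zero_of_notMem hL h0]
    · rfl
    · rintro ⟨x, hx, rfl⟩
      exact hy.2 ⟨e.map_source (hKe hx), hy.1⟩

end LocalStokes

/-! ### The divergence theorem on a region with smooth boundary -/

section OneSided

open DividingHypersurface.AdaptedPartition (slice)

variable {n : ℕ} {M : Type u} [TopologicalSpace M] [ChartedSpace (EuclideanSpace ℝ (Fin (n + 1))) M]
  {μ : FormField (n + 1) (n + 1) M} {U S K Z : Set M} {σ : ℝ}
  {w : (x : M) → TangentSpace (𝓡 (n + 1)) x}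

/-- There are arbitrarily small charts around a point with first coordinate close to a given
value. -/
theorem exists_chart_coord [IsManifold (𝓡 (n + 1)) ∞ M] {V : Set M} (hV : IsOpen V) {p : M}
    (hp : p ∈ V) (a : ℝ) : ∃ e ∈ IsManifold.maximalAtlas (𝓡 (n + 1)) ∞ M, p ∈ e.source ∧
      e.source ⊆ V ∧ ∀ q ∈ e.source, |e q 0 - a| < 1 := by
  set c := chartAt (EuclideanSpace ℝ (Fin (n + 1))) p
  have hc : c ∈ IsManifold.maximalAtlas (𝓡 (n + 1)) ∞ M := IsManifold.chart_mem_maximalAtlas p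
  have hpc : p ∈ c.source := mem_chart_source _ p
  have hs : IsOpen (V ∩ (c.source ∩ c ⁻¹' Metric.ball (c p) 1)) :=
    hV.inter (c.isOpen_inter_preimage Metric.isOpen_ball)
  -- Translation by `v` gives `p` the first coordinate `a`; the unit ball around `c p` keeps the
  -- others within distance `1` of it.
  let v : EuclideanSpace ℝ (Fin (n + 1)) := EuclideanSpace.single 0 (a - c p 0)
  let e := (c.restrOpen _ hs).transHomeomorph (Homeomorph.addRight v)
  have hsrc : e.source = c.source ∩ (V ∩ (c.source ∩ c ⁻¹' Metric.ball (c p) 1)) := rfl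
  refine ⟨e, ?_, ?_, fun q hq => (hsrc ▸ hq).2.1, fun q hq => ?_⟩
  · apply OpenPartialHomeomorph.mem_maximalAtlas_of_contMDiffOn
    · have h1 : ContMDiff (𝓡 (n + 1)) (𝓡 (n + 1)) ∞
          (fun y : EuclideanSpace ℝ (Fin (n + 1)) => y + v) :=
        (contDiff_id.add contDiff_const).contMDiff
      exact h1.comp_contMDiffOn ((contMDiffOn_of_mem_maximalAtlas hc).mono fun q hq => hq.1)
    · have h1 : ContMDiff (𝓡 (n + 1)) (𝓡 (n + 1)) ∞
          (fun y : EuclideanSpace ℝ (Fin (n + 1)) => y + -v) :=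
        (contDiff_id.add contDiff_const).contMDiff
      refine (contMDiffOn_symm_of_mem_maximalAtlas hc).comp h1.contMDiffOn fun y hy => ?_
      have := e.map_target hy
      have h2 : e.symm y = c.symm (y + -v) := rfl
      exact hy.1
  · rw [hsrc]
    exact ⟨hpc, hp, hpc, Metric.mem_ball_self one_pos⟩
  · have h1 : c q ∈ Metric.ball (c p) 1 := hq.2.2.2
    have h2 : e q 0 - a = (c q - c p) 0 := by
      change (c q + v) 0 - a = _
      simp [v]
      ring
    rw [h2, ← Real.norm_eq_abs]
    exact (PiLp.norm_apply_le _ 0).trans_lt (mem_ball_iff_norm.1 h1)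

/-- A partition of unity has only finitely many functions that do not vanish on a compact set. -/
theorem exists_finset_partition {ι : Type*}
    (P : SmoothPartitionOfUnity ι (𝓡 (n + 1)) M Z) (hK : IsCompact K) :
    ∃ F : Finset ι, (∀ i ∉ F, ∀ x ∈ K, P i x = 0) ∧ ∀ x ∈ Z ∩ K, ∑ i ∈ F, P i x = 1 := by
  have hfin := P.locallyFinite.finite_nonempty_inter_compact hK
  have h1 : ∀ i ∉ hfin.toFinset, ∀ x ∈ K, P i x = 0 := by
    intro i hi x hx
    by_contra h
    exact hi (hfin.mem_toFinset.2 ⟨x, h, hx⟩)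
  refine ⟨hfin.toFinset, h1, fun x hx => ?_⟩
  rw [← P.sum_eq_one hx.1]
  refine (finsum_eq_sum_of_support_subset _ fun i hi => ?_).symm
  by_contra h
  exact hi (h1 i h x hx.2)

/-- `U` is an open region with smooth boundary, of closure `S`. -/
structure IsSide (n : ℕ) {M : Type u} [TopologicalSpace M]
    [ChartedSpace (EuclideanSpace ℝ (Fin (n + 1))) M] (U S : Set M) (σ : ℝ) : Prop where
  isOpen : IsOpen U
  isClosed : IsClosed S
  subset : U ⊆ S
  sign : σ = 1 ∨ σ = -1
  exists_halfChart : ∀ p : M, ∃ e : OpenPartialHomeomorph M (EuclideanSpace ℝ (Fin (n + 1))),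
    IsHalfChart U S σ e ∧ p ∈ e.source

variable [IsManifold (𝓡 (n + 1)) ∞ M]

theorem exists_halfChart_partition [T2Space M] [SigmaCompactSpace M] (hside : IsSide n U S σ) :
    ∃ (P : SmoothPartitionOfUnity M (𝓡 (n + 1)) M univ)
      (e : M → OpenPartialHomeomorph M (EuclideanSpace ℝ (Fin (n + 1)))),
      (∀ i, IsHalfChart U S σ (e i)) ∧ P.IsSubordinate fun i => (e i).source := by
  choose e he hp using hside.exists_halfChart
  obtain ⟨P, hP⟩ := SmoothPartitionOfUnity.exists_isSubordinate (𝓡 (n + 1)) isClosed_univ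
    (fun p => (e p).source) (fun p => (e p).open_source) (fun x _ => mem_iUnion.2 ⟨x, hp x⟩)
  exact ⟨P, e, he, hP⟩

/-- The compactly supported vector fields that are smooth on `S`. -/
def sideFields (n : ℕ) {M : Type u} [TopologicalSpace M]
    [ChartedSpace (EuclideanSpace ℝ (Fin (n + 1))) M] [IsManifold (𝓡 (n + 1)) ∞ M] (S : Set M) :
    Submodule ℝ ((x : M) → TangentSpace (𝓡 (n + 1)) x) where
  carrier := {w | SmoothFieldOn w S ∧ ∃ K, IsCompact K ∧ ∀ x ∉ K, w x = 0}
  add_mem' := by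
    rintro a b ⟨ha, K, hK, ha'⟩ ⟨hb, L, hL, hb'⟩
    refine ⟨ha.add hb, K ∪ L, hK.union hL, fun x hx => ?_⟩
    rw [Pi.add_apply, ha' x fun h => hx (Or.inl h), hb' x fun h => hx (Or.inr h), add_zero]
  zero_mem' := ⟨(contMDiff_zeroSection ℝ (TangentSpace (𝓡 (n + 1)) : M → Type _)).contMDiffOn,
    ∅, isCompact_empty, fun _ _ => rfl⟩
  smul_mem' := by
    rintro c a ⟨ha, K, hK, ha'⟩
    refine ⟨ha.const_smul c, K, hK, fun x hx => ?_⟩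
    rw [Pi.smul_apply, ha' x hx, smul_zero]

theorem smul_mem_sideFields {f : M → ℝ} (hf : ContMDiffOn (𝓡 (n + 1)) 𝓘(ℝ, ℝ) ∞ f S)
    (hw : w ∈ sideFields n S) : f • w ∈ sideFields n S := by
  obtain ⟨hw, K, hK, hw'⟩ := hw
  refine ⟨SmoothFieldOn.smul hf hw, K, hK, fun x hx => ?_⟩
  rw [Pi.smul_apply', hw' x hx, smul_zero]

variable [RiemannianBundle (fun x : M => TangentSpace (𝓡 (n + 1)) x)]

theorem divergence_sum (hμ : IsRiemannianVolumeForm μ) {ι : Type*} (F : Finset ι)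
    (v : ι → (x : M) → TangentSpace (𝓡 (n + 1)) x) (hv : ∀ i, v i ∈ sideFields n S) {x : M}
    (hx : S ∈ 𝓝 x) : divergence μ (∑ i ∈ F, v i) x = ∑ i ∈ F, divergence μ (v i) x := by
  classical
  induction F using Finset.induction_on with
  | empty =>
    rw [Finset.sum_empty, Finset.sum_empty]
    exact divergence_eq_zero_of_eventually (Filter.Eventually.of_forall fun _ => rfl)
  | insert i F hi ih =>
    rw [Finset.sum_insert hi, Finset.sum_insert hi,
      divergence_add hμ (hv i).1 ((sideFields n S).sum_mem fun j _ => hv j).1 hx, ih]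

variable [T2Space M] [SigmaCompactSpace M] [MeasurableSpace M] [BorelSpace M]

/-- Each piece `P i • w` is supported in the compact set `tsupport (P i) ∩ K`, which lies in the
domain of its chart, so the local theorem applies to it. -/
theorem partition_smul_divergence (hμ : IsRiemannianVolumeForm μ) (hside : IsSide n U S σ)
    {ι : Type*} (P : SmoothPartitionOfUnity ι (𝓡 (n + 1)) M Z)
    {e : ι → OpenPartialHomeomorph M (EuclideanSpace ℝ (Fin (n + 1)))}
    (he : ∀ i, IsHalfChart U S σ (e i)) (hP : P.IsSubordinate fun i => (e i).source)
    (hw : w ∈ sideFields n S) (i : ι) :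
    (⇑(P i) • w) ∈ sideFields n S ∧
    Integrable (fun y : EuclideanSpace ℝ (Fin n) => chartFlux μ (e i) (⇑(P i) • w) 0 (slice y)) ∧
    IntegrableOn (divergence μ (⇑(P i) • w)) U (volMeasure μ) ∧
      ∫ x in U, divergence μ (⇑(P i) • w) x ∂(volMeasure μ) =
        σ * ∫ y : EuclideanSpace ℝ (Fin n), chartFlux μ (e i) (⇑(P i) • w) 0 (slice y) := by
  have hmem : (⇑(P i) • w) ∈ sideFields n S :=
    smul_mem_sideFields ((P i).contMDiff.contMDiffOn) hw
  obtain ⟨hws, K, hK, hwK⟩ := hw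
  have hK' : IsCompact (tsupport (P i) ∩ K) := hK.inter_left (isClosed_tsupport _)
  have h0 : ∀ x ∉ tsupport (P i) ∩ K, (⇑(P i) • w) x = 0 := by
    intro x hx
    by_cases hxK : x ∈ K
    · have : P i x = 0 := image_eq_zero_of_notMem_tsupport fun h => hx ⟨h, hxK⟩
      rw [Pi.smul_apply', this, zero_smul]
    · rw [Pi.smul_apply', hwK x hxK, smul_zero]
  have hsub : tsupport (P i) ∩ K ⊆ (e i).source := fun x hx => hP i hx.1
  exact ⟨hmem, integrable_chartFlux_slice hμ (he i) hmem.1 hK' hsub h0,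
    integral_divergence_of_support_subset hμ hside.sign (he i) hside.isOpen hside.subset hmem.1 hK'
      hsub h0⟩

/-- A partition of unity on all of `M` cuts `w` into finitely many pieces, each handled in one
chart. If `w` vanishes on the boundary then so do the fluxes of all pieces; this case absorbs the
interior remainder in `integral_divergence_eq_sum`. -/
theorem integrableOn_divergence (hμ : IsRiemannianVolumeForm μ) (hside : IsSide n U S σ)
    (hw : w ∈ sideFields n S) :
    IntegrableOn (divergence μ w) U (volMeasure μ) ∧
      ((∀ x ∈ S \ U, w x = 0) → ∫ x in U, divergence μ w x ∂(volMeasure μ) = 0) := by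
  obtain ⟨P, e, he, hP⟩ := exists_halfChart_partition hside
  obtain ⟨K, hK, hwK⟩ := hw.2
  obtain ⟨F, -, hF1⟩ := exists_finset_partition P hK
  have hsum : w = ∑ i ∈ F, ⇑(P i) • w := by
    funext x
    rw [Finset.sum_apply]
    by_cases hx : x ∈ K
    · simp only [Pi.smul_apply']
      rw [← Finset.sum_smul, hF1 x ⟨mem_univ _, hx⟩, one_smul]
    · simp [Pi.smul_apply', hwK x hx]
  have hpart := partition_smul_divergence hμ hside P he hP hw
  have hdiv : EqOn (divergence μ w) (fun x => ∑ i ∈ F, divergence μ (⇑(P i) • w) x) U := by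
    intro x hx
    conv_lhs => rw [hsum]
    exact divergence_sum hμ F _ (fun i => (hpart i).1)
      (Filter.mem_of_superset (hside.isOpen.mem_nhds hx) hside.subset)
  have hmU := hside.isOpen.measurableSet
  refine ⟨(integrableOn_congr_fun hdiv hmU).2
    (integrable_finsetSum _ fun i _ => (hpart i).2.2.1), fun h0 => ?_⟩
  rw [setIntegral_congr_fun hmU hdiv, integral_finsetSum _ fun i _ => (hpart i).2.2.1]
  refine Finset.sum_eq_zero fun i _ => ?_
  rw [(hpart i).2.2.2]
  refine mul_eq_zero_of_right _ ?_
  refine (integral_congr_ae (Filter.Eventually.of_forall fun y => ?_)).trans (integral_zero _ _)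
  change chartFlux μ (e i) (⇑(P i) • w) 0 (slice y) = 0
  by_cases hy : slice y ∈ (e i).target
  · have hS := ((he i).symm_mem_iff hy).2 (slice_mem_halfSpace σ y)
    have hU' : (e i).symm (slice y) ∉ U := by
      rw [(he i).symm_mem_interior_iff hy]
      change ¬ (σ * (0 : ℝ) < 0)
      simp
    rw [chartFlux, indicator_of_mem hy, chartVec_eq_zero (by
      rw [Pi.smul_apply', h0 _ ⟨hS, hU'⟩, smul_zero])]
    simp
  · exact indicator_of_notMem hy _

/-- The divergence theorem on a region with smooth boundary, with the boundary integral computed by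
means of a partition of unity along the boundary. -/
theorem integral_divergence_eq_sum (hμ : IsRiemannianVolumeForm μ) (hside : IsSide n U S σ)
    {ι : Type*} (P : SmoothPartitionOfUnity ι (𝓡 (n + 1)) M Z) (hZ : S \ U ⊆ Z)
    {e : ι → OpenPartialHomeomorph M (EuclideanSpace ℝ (Fin (n + 1)))}
    (he : ∀ i, IsHalfChart U S σ (e i)) (hP : P.IsSubordinate fun i => (e i).source)
    (hw : w ∈ sideFields n S) (hwK : ∀ x ∉ K, w x = 0) {F : Finset ι}
    (hF : ∀ x ∈ Z ∩ K, ∑ i ∈ F, P i x = 1) :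
    ∫ x in U, divergence μ w x ∂(volMeasure μ) = σ * ∑ i ∈ F,
      ∫ y : EuclideanSpace ℝ (Fin n), chartFlux μ (e i) (⇑(P i) • w) 0 (slice y) := by
  have hpart := partition_smul_divergence hμ hside P he hP hw
  have hsumS : ∑ i ∈ F, ⇑(P i) • w ∈ sideFields n S :=
    (sideFields n S).sum_mem fun i _ => (hpart i).1
  -- The weights sum to `1` only on `Z`. The remainder `w0` vanishes on the boundary, so its
  -- divergence integrates to zero.
  set w0 := w - ∑ i ∈ F, ⇑(P i) • w with hw0
  have hw0S : w0 ∈ sideFields n S := (sideFields n S).sub_mem hw hsumS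
  have hw0Z : ∀ x ∈ S \ U, w0 x = 0 := by
    intro x hx
    rw [hw0, Pi.sub_apply, Finset.sum_apply]
    by_cases hxK : x ∈ K
    · simp only [Pi.smul_apply']
      rw [← Finset.sum_smul, hF x ⟨hZ hx, hxK⟩, one_smul, sub_self]
    · simp [Pi.smul_apply', hwK x hxK]
  obtain ⟨hi0, hint0⟩ := integrableOn_divergence hμ hside hw0S
  have hdiv : EqOn (divergence μ w)
      (fun x => divergence μ w0 x + ∑ i ∈ F, divergence μ (⇑(P i) • w) x) U := by
    intro x hx
    have hn : S ∈ 𝓝 x := Filter.mem_of_superset (hside.isOpen.mem_nhds hx) hside.subset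
    simp only
    rw [← divergence_sum hμ F _ (fun i => (hpart i).1) hn, ← divergence_add hμ hw0S.1 hsumS.1 hn,
      hw0, sub_add_cancel]
  rw [setIntegral_congr_fun hside.isOpen.measurableSet hdiv, integral_add hi0
    (integrable_finsetSum _ fun i _ => (hpart i).2.2.1), hint0 hw0Z, zero_add,
    integral_finsetSum _ fun i _ => (hpart i).2.2.1, Finset.mul_sum]
  exact Finset.sum_congr rfl fun i _ => (hpart i).2.2.2

end OneSided

/-! ### Integrability of the two bulk integrands -/

section ScalarDifferential

variable {n : ℕ} {M : Type u} [TopologicalSpace M] [ChartedSpace (EuclideanSpace ℝ (Fin (n + 1))) M]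
  {μ : FormField (n + 1) (n + 1) M} {U S : Set M} {σ : ℝ} {f g : M → ℝ}
  {w : (x : M) → TangentSpace (𝓡 (n + 1)) x} {x : M}

theorem scalarDifferential_add (hf : ContMDiffOn (𝓡 (n + 1)) 𝓘(ℝ, ℝ) ∞ f S)
    (hg : ContMDiffOn (𝓡 (n + 1)) 𝓘(ℝ, ℝ) ∞ g S) (hS : S ∈ 𝓝 x) :
    scalarDifferential (d := n + 1) (f + g) x = scalarDifferential f x + scalarDifferential g x :=
  mfderiv_add ((hf.contMDiffAt hS).mdifferentiableAt (by simp))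
    ((hg.contMDiffAt hS).mdifferentiableAt (by simp))

theorem scalarDifferential_const_smul (c : ℝ) (hf : ContMDiffOn (𝓡 (n + 1)) 𝓘(ℝ, ℝ) ∞ f S)
    (hS : S ∈ 𝓝 x) : scalarDifferential (d := n + 1) (c • f) x = c • scalarDifferential f x :=
  const_smul_mfderiv ((hf.contMDiffAt hS).mdifferentiableAt (by simp)) c

variable [IsManifold (𝓡 (n + 1)) ∞ M]
  [RiemannianBundle (fun x : M => TangentSpace (𝓡 (n + 1)) x)]
  [T2Space M] [SigmaCompactSpace M] [MeasurableSpace M] [BorelSpace M]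

/-- `f` is bounded on the compact set `S ∩ K`, and the divergence vanishes off `K`. -/
theorem integrableOn_divergence_mul (hμ : IsRiemannianVolumeForm μ) (hside : IsSide n U S σ)
    (hf : ContMDiffOn (𝓡 (n + 1)) 𝓘(ℝ, ℝ) ∞ f S) (hw : w ∈ sideFields n S) :
    IntegrableOn (fun x => divergence μ w x * f x) U (volMeasure μ) := by
  obtain ⟨K, hK, hwK⟩ := hw.2
  obtain ⟨C, hC⟩ := (hK.inter_left hside.isClosed).exists_bound_of_continuousOn
    (hf.continuousOn.mono inter_subset_left)
  have := ChartedSpace.secondCountable_of_sigmaCompact (EuclideanSpace ℝ (Fin (n + 1))) M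
  have hmU := hside.isOpen.measurableSet
  refine ((integrableOn_divergence hμ hside hw).1.norm.mul_const C).mono' ?_ ?_
  · exact ((continuousOn_divergence hμ hside.isOpen (hw.1.mono hside.subset)).mul
      (hf.continuousOn.mono hside.subset)).aestronglyMeasurable hmU
  · refine (ae_restrict_iff' hmU).2 (Filter.Eventually.of_forall fun x hx => ?_)
    by_cases hxK : x ∈ K
    · rw [norm_mul]
      exact mul_le_mul_of_nonneg_left (hC x ⟨hside.subset hx, hxK⟩) (norm_nonneg _)
    · have : divergence μ w x = 0 := divergence_eq_zero_of_eventually (by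
        filter_upwards [hK.isClosed.isOpen_compl.mem_nhds hxK] with z hz using hwK z hz)
      simp [this]

/-- By the Leibniz rule `df(w) = div(f w) - f div(w)`, a difference of integrable functions. -/
theorem integrableOn_scalarDifferential (hμ : IsRiemannianVolumeForm μ) (hside : IsSide n U S σ)
    (hf : ContMDiffOn (𝓡 (n + 1)) 𝓘(ℝ, ℝ) ∞ f S) (hw : w ∈ sideFields n S) :
    IntegrableOn (fun x => scalarDifferential f x (w x)) U (volMeasure μ) := by
  refine (integrableOn_congr_fun (fun x hx => ?_) hside.isOpen.measurableSet).2
    ((integrableOn_divergence hμ hside (smul_mem_sideFields hf hw)).1.sub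
      (integrableOn_divergence_mul hμ hside hf hw))
  have := divergence_smul hμ hf hw.1
    (Filter.mem_of_superset (hside.isOpen.mem_nhds hx) hside.subset)
  simp only [Pi.sub_apply]
  rw [this]
  ring

end ScalarDifferential

namespace DividingHypersurface

/-! ### The two sides of the hypersurface -/

section Sides

variable {n : ℕ} {M : Type u} [TopologicalSpace M] [ChartedSpace (EuclideanSpace ℝ (Fin (n + 1))) M]
  (Γ : DividingHypersurface n M)

variable {Γ} in
theorem IsAdaptedChart.isHalfChart_plus
    {e : OpenPartialHomeomorph M (EuclideanSpace ℝ (Fin (n + 1)))} (he : Γ.IsAdaptedChart e) :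
    IsHalfChart Γ.plus (Γ.plus ∪ Γ.carrier) 1 e := by
  refine ⟨he.1, fun q hq => ?_, fun q hq => ?_⟩
  · change _ ↔ 1 * e q 0 < 0
    rw [one_mul, (he.2 q hq).1]
  · change _ ↔ 1 * e q 0 ≤ 0
    rw [one_mul, mem_union, (he.2 q hq).1, (he.2 q hq).2.1, le_iff_lt_or_eq]

variable {Γ} in
theorem IsAdaptedChart.isHalfChart_minus
    {e : OpenPartialHomeomorph M (EuclideanSpace ℝ (Fin (n + 1)))} (he : Γ.IsAdaptedChart e) :
    IsHalfChart Γ.minus (Γ.minus ∪ Γ.carrier) (-1) e := by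
  refine ⟨he.1, fun q hq => ?_, fun q hq => ?_⟩
  · change _ ↔ -1 * e q 0 < 0
    rw [neg_one_mul, neg_lt_zero, (he.2 q hq).2.2]
  · change _ ↔ -1 * e q 0 ≤ 0
    rw [neg_one_mul, neg_nonpos, mem_union, (he.2 q hq).2.2, (he.2 q hq).2.1, le_iff_lt_or_eq,
      eq_comm (a := (0 : ℝ))]

theorem mem_cases (x : M) : x ∈ Γ.plus ∨ x ∈ Γ.carrier ∨ x ∈ Γ.minus := by
  have : x ∈ Γ.plus ∪ Γ.carrier ∪ Γ.minus := Γ.union_eq ▸ mem_univ x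
  simpa [or_assoc] using this

/-- Away from `Γ` a small chart inside `D⁺` or `D⁻`, shifted so that `x₀` is near `-1` or `1`,
satisfies the three sign conditions trivially. Thus adapted charts cover all of `M`. -/
theorem exists_adaptedChart [IsManifold (𝓡 (n + 1)) ∞ M] (p : M) :
    ∃ e : OpenPartialHomeomorph M (EuclideanSpace ℝ (Fin (n + 1))),
      Γ.IsAdaptedChart e ∧ p ∈ e.source := by
  rcases Γ.mem_cases p with hp | hp | hp
  · obtain ⟨e, he, hpe, heV, h⟩ := exists_chart_coord (n := n) Γ.isOpen_plus hp (-1)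
    refine ⟨e, ⟨he, fun q hq => ?_⟩, hpe⟩
    have h1 := heV hq
    have h2 := disjoint_left.1 Γ.disjoint_plus_carrier h1
    have h3 := disjoint_left.1 Γ.disjoint_plus_minus h1
    have h4 : e q 0 < 0 := by linarith [(abs_lt.1 (h q hq)).2]
    exact ⟨iff_of_true h1 h4, iff_of_false h2 h4.ne, iff_of_false h3 h4.le.not_gt⟩
  · obtain ⟨e, he, hpe, h⟩ := Γ.exists_chart p hp
    exact ⟨e, ⟨he, h⟩, hpe⟩
  · obtain ⟨e, he, hpe, heV, h⟩ := exists_chart_coord (n := n) Γ.isOpen_minus hp 1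
    refine ⟨e, ⟨he, fun q hq => ?_⟩, hpe⟩
    have h1 := heV hq
    have h2 := disjoint_left.1 Γ.disjoint_minus_carrier h1
    have h3 := disjoint_right.1 Γ.disjoint_plus_minus h1
    have h4 : 0 < e q 0 := by linarith [(abs_lt.1 (h q hq)).1]
    exact ⟨iff_of_false h3 h4.le.not_gt, iff_of_false h2 h4.ne', iff_of_true h1 h4⟩

theorem compl_minus : Γ.minusᶜ = Γ.plus ∪ Γ.carrier := by
  ext x
  have h1 := fun h : x ∈ Γ.plus => disjoint_left.1 Γ.disjoint_plus_minus h
  have h2 := fun h : x ∈ Γ.minus => disjoint_left.1 Γ.disjoint_minus_carrier h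
  have h3 := Γ.mem_cases x
  simp only [mem_compl_iff, mem_union]
  tauto

theorem compl_plus : Γ.plusᶜ = Γ.minus ∪ Γ.carrier := by
  ext x
  have h1 := fun h : x ∈ Γ.plus => disjoint_left.1 Γ.disjoint_plus_minus h
  have h2 := fun h : x ∈ Γ.plus => disjoint_left.1 Γ.disjoint_plus_carrier h
  have h3 := Γ.mem_cases x
  simp only [mem_compl_iff, mem_union]
  tauto

theorem isSide_plus [IsManifold (𝓡 (n + 1)) ∞ M] :
    IsSide n Γ.plus (Γ.plus ∪ Γ.carrier) 1 where
  isOpen := Γ.isOpen_plus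
  isClosed := Γ.compl_minus ▸ Γ.isOpen_minus.isClosed_compl
  subset := subset_union_left
  sign := Or.inl rfl
  exists_halfChart p := by
    obtain ⟨e, he, hp⟩ := Γ.exists_adaptedChart p
    exact ⟨e, he.isHalfChart_plus, hp⟩

theorem isSide_minus [IsManifold (𝓡 (n + 1)) ∞ M] :
    IsSide n Γ.minus (Γ.minus ∪ Γ.carrier) (-1) where
  isOpen := Γ.isOpen_minus
  isClosed := Γ.compl_plus ▸ Γ.isOpen_plus.isClosed_compl
  subset := subset_union_left
  sign := Or.inr rfl
  exists_halfChart p := by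
    obtain ⟨e, he, hp⟩ := Γ.exists_adaptedChart p
    exact ⟨e, he.isHalfChart_minus, hp⟩

variable {Γ} in
theorem plus_mem_nhds {x : M} (hx : x ∈ Γ.plus) : Γ.plus ∪ Γ.carrier ∈ 𝓝 x :=
  Filter.mem_of_superset (Γ.isOpen_plus.mem_nhds hx) subset_union_left

variable {Γ} in
theorem minus_mem_nhds {x : M} (hx : x ∈ Γ.minus) : Γ.minus ∪ Γ.carrier ∈ 𝓝 x :=
  Filter.mem_of_superset (Γ.isOpen_minus.mem_nhds hx) subset_union_left

theorem glue_of_mem_plus {F : M → Type*} [∀ x, Zero (F x)] {a b : (x : M) → F x} {x : M}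
    (hx : x ∈ Γ.plus) : Γ.glue a b x = a x := if_pos hx

theorem glue_of_mem_minus {F : M → Type*} [∀ x, Zero (F x)] {a b : (x : M) → F x} {x : M}
    (hx : x ∈ Γ.minus) : Γ.glue a b x = b x :=
  (if_neg (disjoint_right.1 Γ.disjoint_plus_minus hx)).trans (if_pos hx)

theorem glue_of_mem_carrier {F : M → Type*} [∀ x, Zero (F x)] {a b : (x : M) → F x} {x : M}
    (hx : x ∈ Γ.carrier) : Γ.glue a b x = 0 :=
  (if_neg (disjoint_right.1 Γ.disjoint_plus_carrier hx)).trans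
    (if_neg (disjoint_right.1 Γ.disjoint_minus_carrier hx))

/-- To prove an identity at all points it is enough to prove it on `D^±` and on `Γ`. -/
theorem forall_of_forall_mem {p : M → Prop} (h1 : ∀ x ∈ Γ.plus, p x) (h2 : ∀ x ∈ Γ.minus, p x)
    (h3 : ∀ x ∈ Γ.carrier, p x) (x : M) : p x :=
  (Γ.mem_cases x).elim (h1 x) fun h => h.elim (h3 x) (h2 x)

theorem glue_eq_indicator (a b : M → ℝ) :
    Γ.glue (F := fun _ => ℝ) a b = Γ.plus.indicator a + Γ.minus.indicator b := by
  funext x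
  revert x
  refine Γ.forall_of_forall_mem (fun x hx => ?_) (fun x hx => ?_) (fun x hx => ?_)
  · rw [Γ.glue_of_mem_plus hx, Pi.add_apply, indicator_of_mem hx,
      indicator_of_notMem (disjoint_left.1 Γ.disjoint_plus_minus hx), add_zero]
  · rw [Γ.glue_of_mem_minus hx, Pi.add_apply, indicator_of_mem hx,
      indicator_of_notMem (disjoint_right.1 Γ.disjoint_plus_minus hx), zero_add]
  · rw [Γ.glue_of_mem_carrier hx, Pi.add_apply,
      indicator_of_notMem (disjoint_right.1 Γ.disjoint_plus_carrier hx),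
      indicator_of_notMem (disjoint_right.1 Γ.disjoint_minus_carrier hx), add_zero]

theorem integrable_glue [MeasurableSpace M] [BorelSpace M] {ν : Measure M} {a b : M → ℝ}
    (ha : IntegrableOn a Γ.plus ν) (hb : IntegrableOn b Γ.minus ν) :
    Integrable (Γ.glue (F := fun _ => ℝ) a b) ν ∧
      ∫ x, Γ.glue (F := fun _ => ℝ) a b x ∂ν = ∫ x in Γ.plus, a x ∂ν + ∫ x in Γ.minus, b x ∂ν := by
  have h1 := (integrable_indicator_iff Γ.isOpen_plus.measurableSet).2 ha
  have h2 := (integrable_indicator_iff Γ.isOpen_minus.measurableSet).2 hb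
  rw [glue_eq_indicator]
  refine ⟨h1.add h2, ?_⟩
  rw [integral_add' h1 h2, integral_indicator Γ.isOpen_plus.measurableSet,
    integral_indicator Γ.isOpen_minus.measurableSet]

end Sides

/-! ### The functionals `d^R h ⊗ μ` and `T^R f ⊗ μ` -/

section Pairings

variable {n : ℕ} {M : Type u} [TopologicalSpace M] [ChartedSpace (EuclideanSpace ℝ (Fin (n + 1))) M]
  {Γ : DividingHypersurface n M} {μ : FormField (n + 1) (n + 1) M}

theorem funValue_add (f f' : Γ.DiscFunction) (x : M) :
    Γ.funValue (f + f') x = Γ.funValue f x + Γ.funValue f' x := by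
  simp only [funValue, glue]
  split_ifs
  · rfl
  · rfl
  · rw [add_zero]

theorem funValue_smul (c : ℝ) (f : Γ.DiscFunction) (x : M) :
    Γ.funValue (c • f) x = c • Γ.funValue f x := by
  simp only [funValue, glue]
  split_ifs
  · rfl
  · rfl
  · rw [smul_zero]

theorem dR_of_mem_plus (f : Γ.DiscFunction) {x : M} (hx : x ∈ Γ.plus) :
    Γ.dR f x = scalarDifferential f.1.1 x := Γ.glue_of_mem_plus hx

theorem dR_of_mem_minus (f : Γ.DiscFunction) {x : M} (hx : x ∈ Γ.minus) :
    Γ.dR f x = scalarDifferential f.1.2 x := Γ.glue_of_mem_minus hx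

theorem dR_of_mem_carrier (f : Γ.DiscFunction) {x : M} (hx : x ∈ Γ.carrier) :
    Γ.dR f x = 0 := Γ.glue_of_mem_carrier hx

theorem dR_add (f f' : Γ.DiscFunction) (x : M) : Γ.dR (f + f') x = Γ.dR f x + Γ.dR f' x := by
  revert x
  refine Γ.forall_of_forall_mem (fun x hx => ?_) (fun x hx => ?_) (fun x hx => ?_)
  · simp only [dR_of_mem_plus _ hx]
    exact scalarDifferential_add f.2.1 f'.2.1 (plus_mem_nhds hx)
  · simp only [dR_of_mem_minus _ hx]
    exact scalarDifferential_add f.2.2.1 f'.2.2.1 (minus_mem_nhds hx)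
  · simp only [dR_of_mem_carrier _ hx, add_zero]

theorem dR_smul (c : ℝ) (f : Γ.DiscFunction) (x : M) : Γ.dR (c • f) x = c • Γ.dR f x := by
  revert x
  refine Γ.forall_of_forall_mem (fun x hx => ?_) (fun x hx => ?_) (fun x hx => ?_)
  · simp only [dR_of_mem_plus _ hx]
    exact scalarDifferential_const_smul c f.2.1 (plus_mem_nhds hx)
  · simp only [dR_of_mem_minus _ hx]
    exact scalarDifferential_const_smul c f.2.2.1 (minus_mem_nhds hx)
  · simp only [dR_of_mem_carrier _ hx, smul_zero]

variable [IsManifold (𝓡 (n + 1)) ∞ M]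

theorem plus_mem_sideFields (v : Γ.DVect) : v.1.1 ∈ sideFields n (Γ.plus ∪ Γ.carrier) := by
  obtain ⟨v, h1, h2, h3, h4, h5, K, hK, h6⟩ := v
  exact ⟨h1, K, hK, fun x hx => (h6 x hx).1⟩

theorem minus_mem_sideFields (v : Γ.DVect) : v.1.2 ∈ sideFields n (Γ.minus ∪ Γ.carrier) := by
  obtain ⟨v, h1, h2, h3, h4, h5, K, hK, h6⟩ := v
  exact ⟨h2, K, hK, fun x hx => (h6 x hx).2⟩

theorem fieldValue_add (v v' : Γ.DVect) (x : M) :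
    Γ.fieldValue (v + v') x = Γ.fieldValue v x + Γ.fieldValue v' x := by
  simp only [fieldValue, glue]
  split_ifs
  · rfl
  · rfl
  · rw [add_zero]

theorem fieldValue_smul (c : ℝ) (v : Γ.DVect) (x : M) :
    Γ.fieldValue (c • v) x = c • Γ.fieldValue v x := by
  simp only [fieldValue, glue]
  split_ifs
  · rfl
  · rfl
  · rw [smul_zero]

theorem dR_apply_fieldValue (h : Γ.DiscFunction) (v : Γ.DVect) :
    (fun x => Γ.dR h x (Γ.fieldValue v x)) =
      Γ.glue (F := fun _ => ℝ) (fun x => scalarDifferential h.1.1 x (v.1.1 x))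
        (fun x => scalarDifferential h.1.2 x (v.1.2 x)) := by
  funext x
  revert x
  refine Γ.forall_of_forall_mem (fun x hx => ?_) (fun x hx => ?_) (fun x hx => ?_)
  · rw [dR_of_mem_plus h hx, fieldValue, Γ.glue_of_mem_plus hx, Γ.glue_of_mem_plus hx]
  · rw [dR_of_mem_minus h hx, fieldValue, Γ.glue_of_mem_minus hx, Γ.glue_of_mem_minus hx]
  · rw [dR_of_mem_carrier h hx, Γ.glue_of_mem_carrier hx, zero_apply]

theorem divR_mul_funValue (f : Γ.DiscFunction) (v : Γ.DVect) :
    (fun x => Γ.divR μ v x * Γ.funValue f x) =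
      Γ.glue (F := fun _ => ℝ) (fun x => divergence μ v.1.1 x * f.1.1 x)
        (fun x => divergence μ v.1.2 x * f.1.2 x) := by
  funext x
  revert x
  refine Γ.forall_of_forall_mem (fun x hx => ?_) (fun x hx => ?_) (fun x hx => ?_)
  · simp only [divR, funValue, Γ.glue_of_mem_plus hx]
  · simp only [divR, funValue, Γ.glue_of_mem_minus hx]
  · simp only [divR, funValue, Γ.glue_of_mem_carrier hx, zero_mul]

variable [RiemannianBundle (fun x : M => TangentSpace (𝓡 (n + 1)) x)]

theorem divR_add (hμ : IsRiemannianVolumeForm μ) (v v' : Γ.DVect) (x : M) :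
    Γ.divR μ (v + v') x = Γ.divR μ v x + Γ.divR μ v' x := by
  simp only [divR, glue]
  split_ifs with h h'
  · exact divergence_add hμ (plus_mem_sideFields v).1 (plus_mem_sideFields v').1 (plus_mem_nhds h)
  · exact divergence_add hμ (minus_mem_sideFields v).1 (minus_mem_sideFields v').1
      (minus_mem_nhds h')
  · rw [add_zero]

theorem divR_smul (hμ : IsRiemannianVolumeForm μ) (c : ℝ) (v : Γ.DVect) (x : M) :
    Γ.divR μ (c • v) x = c • Γ.divR μ v x := by
  simp only [divR, glue]
  split_ifs with h h'
  · exact divergence_const_smul hμ c (plus_mem_sideFields v).1 (plus_mem_nhds h)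
  · exact divergence_const_smul hμ c (minus_mem_sideFields v).1 (minus_mem_nhds h')
  · rw [smul_zero]

variable [T2Space M] [SigmaCompactSpace M] [MeasurableSpace M] [BorelSpace M]

theorem integrable_dR_fieldValue (hμ : IsRiemannianVolumeForm μ) (h : Γ.DiscFunction)
    (v : Γ.DVect) : Integrable (fun x => Γ.dR h x (Γ.fieldValue v x)) (volMeasure μ) := by
  rw [dR_apply_fieldValue]
  exact (Γ.integrable_glue
    (integrableOn_scalarDifferential hμ Γ.isSide_plus h.2.1 (plus_mem_sideFields v))
    (integrableOn_scalarDifferential hμ Γ.isSide_minus h.2.2.1 (minus_mem_sideFields v))).1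

theorem integrable_divR_mul_funValue (hμ : IsRiemannianVolumeForm μ) (f : Γ.DiscFunction)
    (v : Γ.DVect) : Integrable (fun x => Γ.divR μ v x * Γ.funValue f x) (volMeasure μ) := by
  rw [divR_mul_funValue]
  exact (Γ.integrable_glue
    (integrableOn_divergence_mul hμ Γ.isSide_plus f.2.1 (plus_mem_sideFields v))
    (integrableOn_divergence_mul hμ Γ.isSide_minus f.2.2.1 (minus_mem_sideFields v))).1

/-- The functional `d^R h ⊗ μ`, as a linear function of `h`. -/
def differentialDensity (Γ : DividingHypersurface n M) (hμ : IsRiemannianVolumeForm μ) :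
    Γ.DiscFunction →ₗ[ℝ] Module.Dual ℝ Γ.DVect :=
  LinearMap.mk₂ ℝ (fun h v => Γ.densityPairing μ (Γ.dR h) v)
    (fun h h' v => by
      simp only [densityPairing, dR_add, add_apply]
      exact integral_add (integrable_dR_fieldValue hμ h v) (integrable_dR_fieldValue hμ h' v))
    (fun c h v => by
      simp only [densityPairing, dR_smul, smul_apply]
      exact integral_smul c _)
    (fun h v v' => by
      simp only [densityPairing, fieldValue_add, map_add]
      exact integral_add (integrable_dR_fieldValue hμ h v) (integrable_dR_fieldValue hμ h v'))
    (fun c h v => by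
      simp only [densityPairing, fieldValue_smul, map_smul]
      exact integral_smul c _)

/-- The functional `T^R f ⊗ μ`, as a linear function of `f`. -/
def divergenceDensity (Γ : DividingHypersurface n M) (hμ : IsRiemannianVolumeForm μ) :
    Γ.DiscFunction →ₗ[ℝ] Module.Dual ℝ Γ.DVect :=
  LinearMap.mk₂ ℝ (fun f v => Γ.divergencePairing μ f v)
    (fun f f' v => by
      simp only [divergencePairing, funValue_add, mul_add]
      exact integral_add (integrable_divR_mul_funValue hμ f v)
        (integrable_divR_mul_funValue hμ f' v))
    (fun c f v => by
      simp only [divergencePairing, funValue_smul, mul_smul_comm]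
      exact integral_smul c _)
    (fun f v v' => by
      simp only [divergencePairing, divR_add hμ, add_mul]
      exact integral_add (integrable_divR_mul_funValue hμ f v)
        (integrable_divR_mul_funValue hμ f v'))
    (fun c f v => by
      simp only [divergencePairing, divR_smul hμ, smul_mul_assoc]
      exact integral_smul c _)

/-- By the Leibniz rule, the sum of the two pairings is the integral of `div^R(h v)`. -/
theorem densityPairing_add_divergencePairing (hμ : IsRiemannianVolumeForm μ) (h : Γ.DiscFunction)
    (v : Γ.DVect) :
    Γ.densityPairing μ (Γ.dR h) v + Γ.divergencePairing μ h v =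
      ∫ x in Γ.plus, divergence μ (h.1.1 • v.1.1) x ∂(volMeasure μ) +
        ∫ x in Γ.minus, divergence μ (h.1.2 • v.1.2) x ∂(volMeasure μ) := by
  rw [densityPairing, divergencePairing, ← (Γ.integrable_glue
      (integrableOn_divergence hμ Γ.isSide_plus
        (smul_mem_sideFields h.2.1 (plus_mem_sideFields v))).1
      (integrableOn_divergence hμ Γ.isSide_minus
        (smul_mem_sideFields h.2.2.1 (minus_mem_sideFields v))).1).2]
  rw [← integral_add (integrable_dR_fieldValue hμ h v) (integrable_divR_mul_funValue hμ h v)]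
  congr 1
  funext x
  rw [congrFun (dR_apply_fieldValue h v) x, congrFun (divR_mul_funValue h v) x]
  revert x
  refine Γ.forall_of_forall_mem (fun x hx => ?_) (fun x hx => ?_) (fun x hx => ?_)
  · simp only [Γ.glue_of_mem_plus hx]
    rw [divergence_smul hμ h.2.1 (plus_mem_sideFields v).1 (plus_mem_nhds hx), mul_comm, add_comm]
  · simp only [Γ.glue_of_mem_minus hx]
    rw [divergence_smul hμ h.2.2.1 (minus_mem_sideFields v).1 (minus_mem_nhds hx), mul_comm,
      add_comm]
  · simp only [Γ.glue_of_mem_carrier hx, add_zero]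

end Pairings

end DividingHypersurface

/-! ### The boundary integral and the dual of the anchor -/

theorem AlternatingMap.map_vecCons_sum {V : Type*} [AddCommGroup V] [Module ℝ V] {n : ℕ}
    (η : V [⋀^Fin (n + 1)]→ₗ[ℝ] ℝ) (b : Fin (n + 1) → V) (c : Fin (n + 1) → ℝ) :
    η (Matrix.vecCons (∑ i, c i • b i) fun j => b j.succ) = c 0 * η b := by
  let L : V →ₗ[ℝ] ℝ :=
    { toFun := fun w => η.curryLeft w fun j => b j.succ
      map_add' := fun w w' => by rw [map_add]; rfl
      map_smul' := fun c w => by rw [map_smul]; rfl }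
  have h0 : L (b 0) = η b := by
    change η (Matrix.vecCons (b 0) fun j => b j.succ) = η b
    congr 1
    exact Fin.cons_self_tail b
  -- The vector `b j.succ` then occurs twice among the arguments.
  have h1 : ∀ j : Fin n, L (b j.succ) = 0 := fun j =>
    η.map_eq_zero_of_eq _ (i := 0) (j := j.succ) (by simp) (Fin.succ_ne_zero j).symm
  change L (∑ i, c i • b i) = c 0 * η b
  simp [map_sum, Fin.sum_univ_succ, h0, h1]

namespace DividingHypersurface

open AdaptedPartition (slice)

variable {n : ℕ} {M : Type u} [TopologicalSpace M] [ChartedSpace (EuclideanSpace ℝ (Fin (n + 1))) M]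
  {Γ : DividingHypersurface n M} {μ : FormField (n + 1) (n + 1) M}
  {e : OpenPartialHomeomorph M (EuclideanSpace ℝ (Fin (n + 1)))}

theorem IsAdaptedChart.symm_slice_mem (he : Γ.IsAdaptedChart e) {y : EuclideanSpace ℝ (Fin n)}
    (hy : slice y ∈ e.target) : e.symm (slice y) ∈ Γ.carrier := by
  rw [(he.2 _ (e.map_target hy)).2.1, e.right_inv hy]
  rfl

/-- Expanding `ξ` in the coordinate frame, every component except that along `∂₀` repeats an
argument of `μ`. So `i_ξ μ` restricted to `Γ` sees only the transverse component. -/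
theorem chartCoeff_contract (he : e ∈ IsManifold.maximalAtlas (𝓡 (n + 1)) ∞ M)
    {y : EuclideanSpace ℝ (Fin (n + 1))} (hy : y ∈ e.target)
    (ξ : (x : M) → TangentSpace (𝓡 (n + 1)) x) :
    μ (e.symm y) (Matrix.vecCons (ξ (e.symm y)) fun j : Fin n => coordVector e y j.succ) =
      chartVec e ξ y 0 * chartCoeff μ e y := by
  have h : ξ (e.symm y) = ∑ i, chartVec e ξ y i • coordVector e y i := by
    have h1 : chartVec e ξ y =
        ∑ i, chartVec e ξ y i • (EuclideanSpace.single i 1 : EuclideanSpace ℝ (Fin (n + 1))) := by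
      conv_lhs => rw [← (EuclideanSpace.basisFun (Fin (n + 1)) ℝ).sum_repr (chartVec e ξ y)]
      simp
    have h2 : ξ (e.symm y) = (chartEquiv he (e.map_target hy)).symm (chartVec e ξ y) :=
      ((chartEquiv he (e.map_target hy)).symm_apply_apply _).symm
    rw [h2]
    conv_lhs => rw [h1]
    rw [map_sum]
    refine Finset.sum_congr rfl fun i _ => ?_
    rw [map_smul, coordVector_eq he hy]
  rw [h]
  exact AlternatingMap.map_vecCons_sum (μ (e.symm y)) (coordVector e y) (fun i => chartVec e ξ y i)

/-- A function on `Γ` extends to `M`. -/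
theorem exists_contMDiff_extension [IsManifold (𝓡 (n + 1)) ∞ M] [T2Space M] [SigmaCompactSpace M]
    (ν : Γ.SmoothFunction) :
    ∃ f : M → ℝ, ContMDiff (𝓡 (n + 1)) 𝓘(ℝ, ℝ) ∞ f ∧ ∀ x ∈ Γ.carrier, f x = ν.1 x := by
  -- Prescribing the value on `Γ` and nothing elsewhere is a convex condition at each point, so
  -- local extensions can be averaged by a partition of unity.
  have hconvex : ∀ x, Convex ℝ {c : ℝ | x ∈ Γ.carrier → c = ν.1 x} := by
    intro x
    by_cases hx : x ∈ Γ.carrier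
    · simp [hx]
    · simp [hx, convex_univ]
  have hlocal : ∀ x, ∃ U ∈ 𝓝 x, ∃ g : M → ℝ, ContMDiffOn (𝓡 (n + 1)) 𝓘(ℝ, ℝ) ∞ g U ∧
      ∀ y ∈ U, g y ∈ {c : ℝ | y ∈ Γ.carrier → c = ν.1 y} := by
    intro x
    by_cases hx : x ∈ Γ.carrier
    · obtain ⟨e, he, hxe⟩ := Γ.exists_adaptedChart x
      -- The projection to `x₀ = 0`: in an adapted chart the local extension is constant in the
      -- direction of `x₀`.
      let p : EuclideanSpace ℝ (Fin (n + 1)) → EuclideanSpace ℝ (Fin (n + 1)) :=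
        fun y => y - y 0 • EuclideanSpace.single 0 1
      have hp : ContDiff ℝ ∞ p := by
        have : ContDiff ℝ ∞ fun y : EuclideanSpace ℝ (Fin (n + 1)) => y 0 :=
          (EuclideanSpace.proj 0 : EuclideanSpace ℝ (Fin (n + 1)) →L[ℝ] ℝ).contDiff
        exact contDiff_id.sub (this.smul contDiff_const)
      have hp0 : ∀ y, p y 0 = 0 := fun y => by simp [p]
      have hpid : ∀ y, y 0 = 0 → p y = y := fun y hy => by simp [p, hy]
      have hopen : IsOpen (e.source ∩ e ⁻¹' (p ⁻¹' e.target)) :=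
        e.isOpen_inter_preimage (e.open_target.preimage hp.continuous)
      have hex : e x 0 = 0 := (he.2 x hxe).2.1.1 hx
      refine ⟨e.source ∩ e ⁻¹' (p ⁻¹' e.target), hopen.mem_nhds ⟨hxe, ?_⟩,
        fun q => ν.1 (e.symm (p (e q))), ?_, ?_⟩
      · change p (e x) ∈ e.target
        rw [hpid _ hex]
        exact e.map_source hxe
      · have h1 : ContMDiffOn (𝓡 (n + 1)) 𝓘(ℝ, ℝ) ∞ (fun y => ν.1 (e.symm y))
            (e.target ∩ {y | y 0 = 0}) := by
          refine ν.2.1.comp ((contMDiffOn_symm_of_mem_maximalAtlas he.1).mono inter_subset_left)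
            fun y hy => ?_
          change e.symm y ∈ Γ.carrier
          rw [(he.2 _ (e.map_target hy.1)).2.1, e.right_inv hy.1]
          exact hy.2
        have h2 : ContMDiffOn (𝓡 (n + 1)) (𝓡 (n + 1)) ∞ (fun q => p (e q))
            (e.source ∩ e ⁻¹' (p ⁻¹' e.target)) :=
          hp.contMDiff.comp_contMDiffOn
            ((contMDiffOn_of_mem_maximalAtlas he.1).mono inter_subset_left)
        exact h1.comp h2 fun q hq => ⟨hq.2, hp0 _⟩
      · intro q hq hqΓ
        change ν.1 (e.symm (p (e q))) = ν.1 q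
        rw [hpid _ ((he.2 q hq.1).2.1.1 hqΓ), e.left_inv hq.1]
    · exact ⟨Γ.carrierᶜ, Γ.isClosed_carrier.isOpen_compl.mem_nhds hx, fun _ => 0, contMDiffOn_const,
        fun y hy h => (hy h).elim⟩
  obtain ⟨f, hf⟩ := exists_contMDiffMap_forall_mem_convex_of_local (𝓡 (n + 1)) hconvex hlocal
  exact ⟨f, f.contMDiff, hf⟩

theorem jump_apply_of_mem (h : Γ.DiscFunction) {x : M} (hx : x ∈ Γ.carrier) :
    (Γ.jump h).1 x = h.1.1 x - h.1.2 x :=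
  indicator_of_mem hx (fun x => h.1.1 x - h.1.2 x)

theorem jump_apply_of_notMem (h : Γ.DiscFunction) {x : M} (hx : x ∉ Γ.carrier) :
    (Γ.jump h).1 x = 0 := (Γ.jump h).2.2 x hx

theorem jump_add (h h' : Γ.DiscFunction) : Γ.jump (h + h') = Γ.jump h + Γ.jump h' := by
  refine Subtype.ext (funext fun x => ?_)
  change _ = (Γ.jump h).1 x + (Γ.jump h').1 x
  by_cases hx : x ∈ Γ.carrier
  · rw [jump_apply_of_mem _ hx, jump_apply_of_mem _ hx, jump_apply_of_mem _ hx]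
    exact add_sub_add_comm _ _ _ _
  · rw [jump_apply_of_notMem _ hx, jump_apply_of_notMem _ hx, jump_apply_of_notMem _ hx, add_zero]

theorem jump_smul (c : ℝ) (h : Γ.DiscFunction) : Γ.jump (c • h) = c • Γ.jump h := by
  refine Subtype.ext (funext fun x => ?_)
  change _ = c * (Γ.jump h).1 x
  by_cases hx : x ∈ Γ.carrier
  · rw [jump_apply_of_mem _ hx, jump_apply_of_mem _ hx, mul_sub]
    rfl
  · rw [jump_apply_of_notMem _ hx, jump_apply_of_notMem _ hx, mul_zero]

/-- A smooth extension of `ν` serves as `h⁺`, with `h⁻ = 0`. -/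
theorem exists_jump_eq [IsManifold (𝓡 (n + 1)) ∞ M] [T2Space M] [SigmaCompactSpace M]
    (ν : Γ.SmoothFunction) : ∃ h : Γ.DiscFunction, Γ.jump h = ν := by
  obtain ⟨f, hf, hfν⟩ := exists_contMDiff_extension ν
  refine ⟨⟨((Γ.plus ∪ Γ.carrier).indicator f, 0), ?_, contMDiffOn_const,
    fun x hx => indicator_of_notMem hx _, fun _ _ => rfl⟩, ?_⟩
  · exact hf.contMDiffOn.congr fun x hx => indicator_of_mem hx _
  · refine Subtype.ext (funext fun x => ?_)
    by_cases hx : x ∈ Γ.carrier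
    · rw [jump_apply_of_mem _ hx, ← hfν x hx]
      change (Γ.plus ∪ Γ.carrier).indicator f x - 0 = f x
      have hx' : x ∈ Γ.plus ∪ Γ.carrier := Or.inr hx
      rw [indicator_of_mem hx', sub_zero]
    · rw [jump_apply_of_notMem _ hx, ν.2.2 x hx]

theorem measurableSet_domain (P : Γ.AdaptedPartition) (i : P.index) :
    MeasurableSet (P.domain i) :=
  ((P.chart i).open_target.preimage continuous_slice).measurableSet

/-- A discontinuous function with a given jump. -/
def liftJump [IsManifold (𝓡 (n + 1)) ∞ M] [T2Space M] [SigmaCompactSpace M]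
    (ν : Γ.SmoothFunction) : Γ.DiscFunction := (exists_jump_eq ν).choose

theorem jump_liftJump [IsManifold (𝓡 (n + 1)) ∞ M] [T2Space M] [SigmaCompactSpace M]
    (ν : Γ.SmoothFunction) : Γ.jump (liftJump ν) = ν :=
  (exists_jump_eq ν).choose_spec

variable [IsManifold (𝓡 (n + 1)) ∞ M]

/-- This is the only use of the tangency of `v⁺ - v⁻`: both sides have the same flux density, so a
discontinuity of flux comes from the scalar factor alone. -/
theorem chartVec_plus_eq_minus (he : Γ.IsAdaptedChart e) (v : Γ.DVect)
    {y : EuclideanSpace ℝ (Fin n)} (hy : slice y ∈ e.target) :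
    chartVec e v.1.1 (slice y) 0 = chartVec e v.1.2 (slice y) 0 := by
  have h1 : (chartEquiv he.1 (e.map_target hy)
      (v.1.1 (e.symm (slice y)) - v.1.2 (e.symm (slice y)))) 0 = 0 :=
    v.2.2.2.2.2.1 _ (he.symm_slice_mem hy) e he (e.map_target hy)
  rw [map_sub, PiLp.sub_apply, sub_eq_zero] at h1
  exact h1

variable [RiemannianBundle (fun x : M => TangentSpace (𝓡 (n + 1)) x)]

/-- The projection removes a vector tangent to `Γ`, which has no `x₀` component. Hence the choice of
normal direction by the metric does not affect the flux. -/
theorem chartVec_anchor (he : Γ.IsAdaptedChart e) (v : Γ.DVect)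
    {y : EuclideanSpace ℝ (Fin (n + 1))} (hy : y ∈ e.target) :
    chartVec e (Γ.anchor v) y 0 = chartVec e v.1.1 y 0 := by
  have hfd : FiniteDimensional ℝ (TangentSpace (𝓡 (n + 1)) (e.symm y)) :=
    inferInstanceAs (FiniteDimensional ℝ (EuclideanSpace ℝ (Fin (n + 1))))
  obtain ⟨t, ht, hanchor⟩ : ∃ t ∈ Γ.tangent (e.symm y),
      Γ.anchor v (e.symm y) = v.1.1 (e.symm y) - t :=
    ⟨_, Submodule.starProjection_apply_mem _ _, rfl⟩
  have h1 : (chartEquiv he.1 (e.map_target hy) t) 0 = 0 := ht e he (e.map_target hy)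
  rw [chartVec_eq he.1 hy, chartVec_eq he.1 hy, hanchor, map_sub, PiLp.sub_apply, h1, sub_zero]

/-- The orientation sign in the boundary integral combines with `ρ` to `sign(ρ) ρ = |ρ|`, the
density that appears in the bulk integrals. -/
theorem integrand_eq (P : Γ.AdaptedPartition) (ν : M → ℝ) (v : Γ.DVect) (i : P.index)
    {y : EuclideanSpace ℝ (Fin n)} (hy : y ∈ P.domain i) :
    P.integrand μ (contractForm μ ν (Γ.anchor v)) i y =
      P.weight i ((P.chart i).symm (slice y)) * ν ((P.chart i).symm (slice y)) *
        (|chartCoeff μ (P.chart i) (slice y)| * chartVec (P.chart i) v.1.1 (slice y) 0) := by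
  have hy' : slice y ∈ (P.chart i).target := hy
  have h1 : contractForm μ ν (Γ.anchor v) ((P.chart i).symm (slice y))
      (fun j => coordVector (P.chart i) (slice y) j.succ) =
      ν ((P.chart i).symm (slice y)) * (chartVec (P.chart i) v.1.1 (slice y) 0 *
        chartCoeff μ (P.chart i) (slice y)) := by
    rw [← chartVec_anchor (P.adapted i) v hy', ← chartCoeff_contract (P.adapted i).1 hy']
    rfl
  have h2 : ∀ r : ℝ, r.sign * r = |r| := by
    intro r
    rcases lt_trichotomy r 0 with h | rfl | h
    · rw [Real.sign_of_neg h, abs_of_neg h, neg_one_mul]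
    · simp
    · rw [Real.sign_of_pos h, abs_of_pos h, one_mul]
  rw [AdaptedPartition.integrand, h1, ← h2]
  ring

theorem integrand_eq_chartFlux_sub (P : Γ.AdaptedPartition) (h : Γ.DiscFunction) (v : Γ.DVect)
    (i : P.index) {y : EuclideanSpace ℝ (Fin n)} (hy : y ∈ P.domain i) :
    P.integrand μ (contractForm μ (Γ.jump h).1 (Γ.anchor v)) i y =
      chartFlux μ (P.chart i) (⇑(P.weight i) • h.1.1 • v.1.1) 0 (slice y) -
        chartFlux μ (P.chart i) (⇑(P.weight i) • h.1.2 • v.1.2) 0 (slice y) := by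
  have hy' : slice y ∈ (P.chart i).target := hy
  have hjump : (Γ.jump h).1 ((P.chart i).symm (slice y)) =
      h.1.1 ((P.chart i).symm (slice y)) - h.1.2 ((P.chart i).symm (slice y)) :=
    jump_apply_of_mem h ((P.adapted i).symm_slice_mem hy')
  rw [integrand_eq P _ v i hy, hjump, chartFlux, chartFlux, indicator_of_mem hy',
    indicator_of_mem hy']
  simp only [chartVec_smul, PiLp.smul_apply, smul_eq_mul]
  rw [chartVec_plus_eq_minus (P.adapted i) v hy']
  ring

variable [T2Space M] [SigmaCompactSpace M] [MeasurableSpace M] [BorelSpace M]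

/-- The boundary integral converges, and it equals the sum of the two bulk pairings. -/
theorem anchorPairing_jump (hμ : IsRiemannianVolumeForm μ) (P : Γ.AdaptedPartition)
    (h : Γ.DiscFunction) (v : Γ.DVect) :
    P.IsIntegrable μ (contractForm μ (Γ.jump h).1 (Γ.anchor v)) ∧
      Γ.anchorPairing P μ (Γ.jump h) v =
        Γ.densityPairing μ (Γ.dR h) v + Γ.divergencePairing μ h v := by
  obtain ⟨K, hK, hvK⟩ := v.2.2.2.2.2.2
  -- `K` supports both fields, and only indices in `F` have a weight that is nonzero somewhere on
  -- `K`; so `F` contains every contributing chart.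
  obtain ⟨F, hF0, hF1⟩ := exists_finset_partition P.weight hK
  have hplus := smul_mem_sideFields h.2.1 (plus_mem_sideFields v)
  have hminus := smul_mem_sideFields h.2.2.1 (minus_mem_sideFields v)
  have hp := partition_smul_divergence hμ Γ.isSide_plus P.weight
    (fun i => (P.adapted i).isHalfChart_plus) P.subordinate hplus
  have hm := partition_smul_divergence hμ Γ.isSide_minus P.weight
    (fun i => (P.adapted i).isHalfChart_minus) P.subordinate hminus
  have hZp : (Γ.plus ∪ Γ.carrier) \ Γ.plus ⊆ Γ.carrier := fun x hx => hx.1.resolve_left hx.2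
  have hZm : (Γ.minus ∪ Γ.carrier) \ Γ.minus ⊆ Γ.carrier := fun x hx => hx.1.resolve_left hx.2
  have hzero : ∀ i ∉ F, ∀ y ∈ P.domain i,
      P.integrand μ (contractForm μ (Γ.jump h).1 (Γ.anchor v)) i y = 0 := by
    intro i hi y hy
    rw [integrand_eq P _ v i hy]
    by_cases hx : (P.chart i).symm (slice y) ∈ K
    · rw [hF0 i hi _ hx]
      ring
    · rw [chartVec_eq_zero (hvK _ hx).1]
      simp
  have hint : ∀ i, ∫ y in P.domain i,
      P.integrand μ (contractForm μ (Γ.jump h).1 (Γ.anchor v)) i y =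
      (∫ y : EuclideanSpace ℝ (Fin n),
        chartFlux μ (P.chart i) (⇑(P.weight i) • h.1.1 • v.1.1) 0 (slice y)) -
      ∫ y : EuclideanSpace ℝ (Fin n),
        chartFlux μ (P.chart i) (⇑(P.weight i) • h.1.2 • v.1.2) 0 (slice y) := by
    intro i
    rw [← integral_sub (hp i).2.1 (hm i).2.1, setIntegral_congr_fun (measurableSet_domain P i)
      (fun y hy => integrand_eq_chartFlux_sub P h v i hy)]
    refine setIntegral_eq_integral_of_forall_compl_eq_zero fun y hy => ?_
    have hy' : slice y ∉ (P.chart i).target := hy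
    rw [chartFlux, chartFlux, indicator_of_notMem hy', indicator_of_notMem hy', sub_zero]
  refine ⟨⟨fun i => ?_, F.finite_toSet.subset fun i hi => ?_⟩, ?_⟩
  · exact ((hp i).2.1.sub (hm i).2.1).integrableOn.congr_fun
      (fun y hy => (integrand_eq_chartFlux_sub P h v i hy).symm) (measurableSet_domain P i)
  · obtain ⟨y, hy, hne⟩ := hi
    by_contra hiF
    exact hne (hzero i hiF y hy)
  -- The divergence theorem is applied on both sides with the same charts and weights. The signs `1`
  -- and `-1` turn the sum of the boundary terms into a difference, which is matched with the
  -- integral over `Γ` chart by chart.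
  · rw [densityPairing_add_divergencePairing hμ,
      integral_divergence_eq_sum hμ Γ.isSide_plus P.weight hZp
        (fun i => (P.adapted i).isHalfChart_plus) P.subordinate hplus (K := K)
        (fun x hx => by rw [Pi.smul_apply', (hvK x hx).1, smul_zero]) hF1,
      integral_divergence_eq_sum hμ Γ.isSide_minus P.weight hZm
        (fun i => (P.adapted i).isHalfChart_minus) P.subordinate hminus (K := K)
        (fun x hx => by rw [Pi.smul_apply', (hvK x hx).2, smul_zero]) hF1,
      one_mul, neg_one_mul, ← sub_eq_add_neg, ← Finset.sum_sub_distrib, anchorPairing,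
      AdaptedPartition.integral]
    rw [finsum_eq_sum_of_support_subset (s := F)]
    · exact Finset.sum_congr rfl fun i _ => hint i
    · intro i hi
      by_contra hiF
      exact hi (setIntegral_eq_zero_of_forall_eq_zero fun y hy => hzero i hiF y hy)

/-- The functional `(d^R h + T^R h) ⊗ μ`, as a linear function of `h`. -/
def totalDensity (Γ : DividingHypersurface n M) (hμ : IsRiemannianVolumeForm μ) :
    Γ.DiscFunction →ₗ[ℝ] Module.Dual ℝ Γ.DVect :=
  Γ.differentialDensity hμ + Γ.divergenceDensity hμ

theorem totalDensity_apply (hμ : IsRiemannianVolumeForm μ) (P : Γ.AdaptedPartition)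
    (h : Γ.DiscFunction) (v : Γ.DVect) :
    Γ.totalDensity hμ h v = Γ.anchorPairing P μ (Γ.jump h) v :=
  (anchorPairing_jump hμ P h v).2.symm

/-- The sum of the two densities depends only on the jump. -/
theorem totalDensity_congr (hμ : IsRiemannianVolumeForm μ) {h h' : Γ.DiscFunction}
    (hj : Γ.jump h = Γ.jump h') : Γ.totalDensity hμ h = Γ.totalDensity hμ h' := by
  -- Any adapted partition will do, as the two functionals do not involve it.
  obtain ⟨P⟩ := Γ.nonempty_adaptedPartition
  refine LinearMap.ext fun v => ?_
  rw [totalDensity_apply hμ P, totalDensity_apply hμ P, hj]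

/-- The dual of the anchor. -/
def anchorDual (Γ : DividingHypersurface n M) (hμ : IsRiemannianVolumeForm μ) :
    Γ.SmoothFunction →ₗ[ℝ] Module.Dual ℝ Γ.DVect where
  -- The lift is an arbitrary choice, not a linear map. Linearity follows because the total density
  -- depends only on the jump; no additivity of the boundary integral is needed, and no partition
  -- enters the definition.
  toFun ν := Γ.totalDensity hμ (liftJump ν)
  map_add' ν ν' := by
    have h : Γ.jump (liftJump (ν + ν')) = Γ.jump (liftJump ν + liftJump ν') := by
      rw [jump_add, jump_liftJump, jump_liftJump, jump_liftJump]
    exact (totalDensity_congr hμ h).trans (LinearMap.map_add _ _ _)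
  map_smul' c ν := by
    have h : Γ.jump (liftJump (c • ν)) = Γ.jump (c • liftJump ν) := by
      rw [jump_smul, jump_liftJump, jump_liftJump]
    exact (totalDensity_congr hμ h).trans (LinearMap.map_smul _ _ _)

theorem anchorDual_jump (hμ : IsRiemannianVolumeForm μ) (h : Γ.DiscFunction) :
    Γ.anchorDual hμ (Γ.jump h) = Γ.differentialDensity hμ h + Γ.divergenceDensity hμ h :=
  totalDensity_congr hμ (jump_liftJump (Γ.jump h))

end DividingHypersurface

end

theorem mainTheorem5 {n : ℕ} {M : Type u} [TopologicalSpace M] [T2Space M] [SigmaCompactSpace M]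
    [ChartedSpace (EuclideanSpace ℝ (Fin (n + 1))) M] [IsManifold (𝓡 (n + 1)) ∞ M]
    [MeasurableSpace M] [BorelSpace M]
    [RiemannianBundle (fun x : M => TangentSpace (𝓡 (n + 1)) x)]
    [IsContMDiffRiemannianBundle (𝓡 (n + 1)) ∞ (EuclideanSpace ℝ (Fin (n + 1)))
      (fun x : M => TangentSpace (𝓡 (n + 1)) x)]
    (μ : FormField (n + 1) (n + 1) M) (hμ : IsRiemannianVolumeForm μ)
    (Γ : DividingHypersurface n M) :
    ∃ (anchorDual : Γ.SmoothFunction →ₗ[ℝ] Module.Dual ℝ Γ.DVect)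
      (dRdensity T : Γ.DiscFunction →ₗ[ℝ] Module.Dual ℝ Γ.DVect),
      (∀ (P : Γ.AdaptedPartition) (ν : Γ.SmoothFunction) (v : Γ.DVect),
        P.IsIntegrable μ (contractForm μ ν.1 (Γ.anchor v)) ∧
        anchorDual ν v = Γ.anchorPairing P μ ν v) ∧
      (∀ (h : Γ.DiscFunction) (v : Γ.DVect),
        Integrable (fun x => Γ.dR h x (Γ.fieldValue v x)) (volMeasure μ) ∧
        dRdensity h v = Γ.densityPairing μ (Γ.dR h) v) ∧
      (∀ (f : Γ.DiscFunction) (v : Γ.DVect),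
        Integrable (fun x => Γ.divR μ v x * Γ.funValue f x) (volMeasure μ) ∧
        T f v = Γ.divergencePairing μ f v) ∧
      ∀ ν : Γ.SmoothFunction,
        {φ | ∃ h : Γ.DiscFunction, Γ.jump h = ν ∧ φ = dRdensity h + T h} = {anchorDual ν} := by
  refine ⟨Γ.anchorDual hμ, Γ.differentialDensity hμ, Γ.divergenceDensity hμ, fun P ν v => ?_,
    fun h v => ⟨DividingHypersurface.integrable_dR_fieldValue hμ h v, rfl⟩,
    fun f v => ⟨DividingHypersurface.integrable_divR_mul_funValue hμ f v, rfl⟩, fun ν => ?_⟩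
  -- Writing `ν` as a jump reduces convergence and value of the boundary integral to
  -- `anchorPairing_jump`, for every partition `P`.
  · obtain ⟨h, rfl⟩ := DividingHypersurface.exists_jump_eq ν
    have := DividingHypersurface.anchorPairing_jump hμ P h v
    refine ⟨this.1, ?_⟩
    rw [this.2, DividingHypersurface.anchorDual_jump]
    rfl
  · ext φ
    constructor
    · rintro ⟨h, rfl, rfl⟩
      exact (DividingHypersurface.anchorDual_jump hμ h).symm
    · rintro rfl
      obtain ⟨h, rfl⟩ := DividingHypersurface.exists_jump_eq ν
      exact ⟨h, rfl, DividingHypersurface.anchorDual_jump hμ h⟩
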